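/- Let $\lambda\in\mathbb C$ with $|\lambda|>1$, and let $\varphi\in\mathrm{Diff}^\infty([0,\infty))$ be expanding, i.e. $\varphi(x)>x$ for all $x>0$. Let $\tilde R=(\mathbb C\times[0,\infty))\setminus\{(0,0)\}$, foliated by the complex leaves $\mathbb C\times\{x\}$ ($x>0$) and $\mathbb C^*\times\{0\}$, let $T(z,x)=(\lambda z,\varphi(x))$, and let $R=\tilde R/T^{\mathbb Z}$ be the $3$-dimensional Reeb component with complex leaves obtained as the quotient (the Hopf construction). For a foliation with complex leaves, $\mathrm{Aut}$ denotes the group of all smooth diffeomorphisms that preserve the foliation and are holomorphic along the leaves. Let $\mathrm{Aut}(\tilde R;T)$ be the centralizer of $T$ in $\mathrm{Aut}\,\tilde R$, let $Z_\varphi$ be the centralizer of $\varphi$ in $\mathrm{Diff}^\infty([0,\infty))$, and let $$\mathcal K_{\lambda,\varphi}=\{b\in C^\infty([0,\infty),\mathbb C)\;:\; b(\varphi(x))=\lambda b(x)\ \text{ for all }x\ge 0\},$$ an additive group. (i) Passing to the quotient induces an isomorphism $\mathrm{Aut}(\tilde R;T)/T^{\mathbb Z}\cong\mathrm{Aut}\,R$.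 (ii) There is a well-defined action by automorphisms of the group $(\mathbb C^*\times Z_\varphi)/(\lambda,\varphi)^{\mathbb Z}$ on $\mathcal K_{\lambda,\varphi}$, in which the class of $(a,\eta)$ acts by $b\mapsto a^{-1}\,(b\circ\eta)$; thus $a\in\mathbb C^*$ acts by $b\mapsto a^{-1}b$ and $\eta\in Z_\varphi$ by $b\mapsto b\circ\eta$. (iii) $\mathrm{Aut}\,R$ is isomorphic to the semidirect product $$\mathcal K_{\lambda,\varphi}\rtimes\left\{(\mathbb C^*\times Z_\varphi)/(\lambda,\varphi)^{\mathbb Z}\right\}$$ for this action. The isomorphism can be chosen so that, under the identification (i), the class of $(z,x)\mapsto(z+b(x),x)$ corresponds to $b\in\mathcal K_{\lambda,\varphi}$, and the class of $(z,x)\mapsto(az,\eta(x))$ corresponds to the inverse of the class of $(a,\eta)$. -/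

import Mathlib

open Set Topology
open scoped NNReal ContDiff Manifold

noncomputable section

/-! ### Foliations with complex leaves of complex dimension one and real codimension one -/

/-- The local model `ℂ × [0, ∞)` of a `3`-manifold with boundary, foliated by the slices
`ℂ × {x}`, which carry the standard complex structure. -/
abbrev LeafModel : Type := ℂ × ℝ≥0

namespace LeafModel

/-- The inclusion of `ℂ × [0, ∞)` in the vector space `ℂ × ℝ`. -/
def incl (p : LeafModel) : ℂ × ℝ := (p.1, (p.2 : ℝ))

/-- A retraction of `ℂ × ℝ` onto `ℂ × [0, ∞)`, used only to extend functions arbitrarily. -/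
def retr (p : ℂ × ℝ) : LeafModel := (p.1, p.2.toNNReal)

theorem retr_incl (p : LeafModel) : retr (incl p) = p := by
  simp [retr, incl]

theorem continuous_retr : Continuous retr := by
  unfold retr
  fun_prop

theorem continuous_incl : Continuous incl := by
  unfold incl
  fun_prop

/-- A map `f (z, x) = (w, t)` on the open set `s` of `ℂ × [0, ∞)` is a leafwise holomorphic
foliated map if it is smooth (up to the boundary), `t` depends locally only on `x`, and `w` is
holomorphic in `z` when `x` is fixed. -/
structure IsLeafwise (f : LeafModel → LeafModel) (s : Set LeafModel) : Prop where
  smooth : ContDiffOn ℝ ∞ (incl ∘ f ∘ retr) (incl '' s)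
  foliated : ∀ p ∈ s, ∃ v : Set LeafModel, IsOpen v ∧ p ∈ v ∧
    ∀ q ∈ s ∩ v, ∀ q' ∈ s ∩ v, q.2 = q'.2 → (f q).2 = (f q').2
  holomorphic : ∀ p ∈ s, DifferentiableAt ℂ (fun z : ℂ => (f (z, p.2)).1) p.1

theorem IsLeafwise.mono {f : LeafModel → LeafModel} {s t : Set LeafModel}
    (h : IsLeafwise f s) (hts : t ⊆ s) : IsLeafwise f t where
  smooth := h.smooth.mono (image_mono hts)
  foliated p hp := by
    obtain ⟨v, hv, hpv, H⟩ := h.foliated p (hts hp)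
    exact ⟨v, hv, hpv, fun q hq q' hq' => H q ⟨hts hq.1, hq.2⟩ q' ⟨hts hq'.1, hq'.2⟩⟩
  holomorphic p hp := h.holomorphic p (hts hp)

theorem IsLeafwise.congr {f g : LeafModel → LeafModel} {s : Set LeafModel} (hs : IsOpen s)
    (hfg : ∀ p ∈ s, g p = f p) (h : IsLeafwise f s) : IsLeafwise g s where
  smooth := by
    refine h.smooth.congr ?_
    rintro _ ⟨p, hp, rfl⟩
    simp [retr_incl, hfg p hp]
  foliated p hp := by
    obtain ⟨v, hv, hpv, H⟩ := h.foliated p hp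
    refine ⟨v, hv, hpv, fun q hq q' hq' hqq => ?_⟩
    rw [hfg q hq.1, hfg q' hq'.1]
    exact H q hq q' hq' hqq
  holomorphic p hp := by
    refine (h.holomorphic p hp).congr_of_eventuallyEq ?_
    have hc : Continuous fun z : ℂ => ((z, p.2) : LeafModel) := by fun_prop
    filter_upwards [(hs.preimage hc).mem_nhds (show p.1 ∈ _ from hp)] with z hz
    rw [hfg _ hz]

/-- The pseudogroup of leafwise holomorphic foliated maps. -/
def pregroupoid : Pregroupoid LeafModel where
  property := IsLeafwise
  comp := by
    intro f g u v hf hg hu hv huv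
    have hfc : ∀ p ∈ u, ContinuousAt f p := by
      intro p hp
      have h1 : ContinuousOn (incl ∘ f ∘ retr) (incl '' u) := hf.smooth.continuousOn
      have h2 : ContinuousOn (retr ∘ (incl ∘ f ∘ retr) ∘ incl) u :=
        continuous_retr.comp_continuousOn
          (h1.comp continuous_incl.continuousOn (mapsTo_image _ _))
      have h3 : retr ∘ (incl ∘ f ∘ retr) ∘ incl = f := by
        funext q
        simp [retr_incl]
      rw [h3] at h2
      exact h2.continuousAt (hu.mem_nhds hp)
    refine ⟨?_, ?_, ?_⟩
    · have h1 : incl ∘ (g ∘ f) ∘ retr = (incl ∘ g ∘ retr) ∘ (incl ∘ f ∘ retr) := by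
        funext q
        simp [retr_incl]
      rw [h1]
      refine hg.smooth.comp (hf.smooth.mono (image_mono inter_subset_left)) ?_
      rintro _ ⟨p, hp, rfl⟩
      exact ⟨f p, hp.2, by simp [retr_incl]⟩
    · rintro p ⟨hp, hfp⟩
      obtain ⟨v₁, hv₁, hpv₁, H₁⟩ := hf.foliated p hp
      obtain ⟨v₂, hv₂, hpv₂, H₂⟩ := hg.foliated (f p) hfp
      obtain ⟨w, hw, hwo, hpw⟩ := mem_nhds_iff.1 ((hfc p hp).preimage_mem_nhds (hv₂.mem_nhds hpv₂))
      refine ⟨v₁ ∩ w, hv₁.inter hwo, ⟨hpv₁, hpw⟩, ?_⟩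
      rintro q ⟨⟨hq, hfq⟩, hq₁, hq₂⟩ q' ⟨⟨hq', hfq'⟩, hq₁', hq₂'⟩ hqq
      exact H₂ _ ⟨hfq, hw hq₂⟩ _ ⟨hfq', hw hq₂'⟩ (H₁ _ ⟨hq, hq₁⟩ _ ⟨hq', hq₁'⟩ hqq)
    · rintro p ⟨hp, hfp⟩
      obtain ⟨v₁, hv₁, hpv₁, H₁⟩ := hf.foliated p hp
      have hc : Continuous fun z : ℂ => ((z, p.2) : LeafModel) := by fun_prop
      have h1 : DifferentiableAt ℂ
          ((fun w : ℂ => (g (w, (f p).2)).1) ∘ fun z : ℂ => (f (z, p.2)).1) p.1 :=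
        DifferentiableAt.comp p.1 (hg.holomorphic (f p) hfp) (hf.holomorphic p hp)
      refine h1.congr_of_eventuallyEq ?_
      filter_upwards [((hu.inter hv₁).preimage hc).mem_nhds
        (show p.1 ∈ _ from ⟨hp, hpv₁⟩)] with z hz
      have h2 : (f (z, p.2)).2 = (f p).2 := H₁ _ hz _ ⟨hp, hpv₁⟩ rfl
      simp only [Function.comp_apply]
      rw [← h2]
  id_mem := by
    refine ⟨?_, fun p _ => ⟨univ, isOpen_univ, mem_univ p, fun q _ q' _ h => h⟩, fun p _ => ?_⟩
    · refine contDiffOn_id.congr ?_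
      rintro _ ⟨p, -, rfl⟩
      simp [retr_incl]
    · exact differentiableAt_id
  locality := by
    intro f u hu H
    refine ⟨?_, ?_, ?_⟩
    · rintro _ ⟨p, hp, rfl⟩
      obtain ⟨v, hv, hpv, h⟩ := H p hp
      refine (h.smooth (incl p) ⟨p, ⟨hp, hpv⟩, rfl⟩).mono_of_mem_nhdsWithin ?_
      have h1 : retr ⁻¹' v ∈ 𝓝 (incl p) :=
        continuous_retr.continuousAt.preimage_mem_nhds (by rw [retr_incl]; exact hv.mem_nhds hpv)
      filter_upwards [self_mem_nhdsWithin, mem_nhdsWithin_of_mem_nhds h1]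
      rintro _ ⟨q, hq, rfl⟩ hqv
      exact ⟨q, ⟨hq, by simpa [retr_incl] using hqv⟩, rfl⟩
    · intro p hp
      obtain ⟨v, hv, hpv, h⟩ := H p hp
      obtain ⟨w, hw, hpw, h'⟩ := h.foliated p ⟨hp, hpv⟩
      refine ⟨v ∩ w, hv.inter hw, ⟨hpv, hpw⟩, fun q hq q' hq' => ?_⟩
      exact h' q ⟨⟨hq.1, hq.2.1⟩, hq.2.2⟩ q' ⟨⟨hq'.1, hq'.2.1⟩, hq'.2.2⟩
    · intro p hp
      obtain ⟨v, hv, hpv, h⟩ := H p hp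
      exact h.holomorphic p ⟨hp, hpv⟩
  congr := by
    intro f g u hu hfg h
    exact h.congr hu hfg

/-- The groupoid of leafwise biholomorphic foliated local diffeomorphisms of `ℂ × [0, ∞)`: the
admissible coordinate changes of a foliation with complex leaves. A space `M` with
`ChartedSpace LeafModel M` and `HasGroupoid M LeafModel.groupoid` is a `3`-manifold with boundary,
with a foliation by complex curves that is tangent to the boundary. -/
def groupoid : StructureGroupoid LeafModel := pregroupoid.groupoid

instance : ClosedUnderRestriction groupoid where
  closedUnderRestriction := by
    intro e he s hs
    refine ⟨he.1.mono ?_, he.2.mono ?_⟩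
    · intro p hp
      exact hp.1
    · intro p hp
      exact hp.1

end LeafModel

/-- The group of automorphisms of a foliation with complex leaves: the homeomorphisms that, read
in the foliated charts, are smooth with smooth inverse, preserve the foliation and are holomorphic
along the leaves. -/
def leafAut (M : Type) [TopologicalSpace M] [ChartedSpace LeafModel M]
    [HasGroupoid M LeafModel.groupoid] : Subgroup (M ≃ₜ M) where
  carrier := {f | ∀ c ∈ atlas LeafModel M, ∀ c' ∈ atlas LeafModel M,
    c.symm ≫ₕ f.toOpenPartialHomeomorph ≫ₕ c' ∈ LeafModel.groupoid}
  one_mem' := fun c hc c' hc' =>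
    (Structomorph.refl (G := LeafModel.groupoid) M).mem_groupoid c c' hc hc'
  mul_mem' := by
    intro f g hf hg c hc c' hc'
    exact (Structomorph.trans
      (⟨g, fun c c' hc hc' => hg c hc c' hc'⟩ : Structomorph LeafModel.groupoid M M)
      ⟨f, fun c c' hc hc' => hf c hc c' hc'⟩).mem_groupoid c c' hc hc'
  inv_mem' := by
    intro f hf c hc c' hc'
    exact (Structomorph.symm
      (⟨f, fun c c' hc hc' => hf c hc c' hc'⟩ : Structomorph LeafModel.groupoid M M)).mem_groupoid
        c c' hc hc'

/-! ### Diffeomorphisms of the half line -/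

/-- Smoothness on `[0, ∞)`, up to the boundary point. -/
def SmoothHalf {E : Type} [NormedAddCommGroup E] [NormedSpace ℝ E] (f : ℝ≥0 → E) : Prop :=
  ContDiffOn ℝ ∞ (fun x : ℝ => f x.toNNReal) (Ici 0)

theorem SmoothHalf.comp {E : Type} [NormedAddCommGroup E] [NormedSpace ℝ E] {f : ℝ≥0 → E}
    {g : ℝ≥0 → ℝ≥0} (hf : SmoothHalf f) (hg : SmoothHalf fun x => (g x : ℝ)) :
    SmoothHalf fun x => f (g x) := by
  have h : ContDiffOn ℝ ∞ ((fun x : ℝ => f x.toNNReal) ∘ fun x : ℝ => (g x.toNNReal : ℝ)) (Ici 0) :=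
    ContDiffOn.comp hf hg fun x _ => (g x.toNNReal).2
  refine h.congr fun x _ => ?_
  simp

theorem smoothHalf_id : SmoothHalf fun x : ℝ≥0 => (x : ℝ) :=
  contDiffOn_id.congr fun x hx => Real.coe_toNNReal x hx

/-- The group `Diff^∞([0, ∞))`. -/
def DiffHalf : Subgroup (ℝ≥0 ≃ₜ ℝ≥0) where
  carrier := {f | (SmoothHalf fun x => (f x : ℝ)) ∧ SmoothHalf fun x => (f.symm x : ℝ)}
  one_mem' := ⟨smoothHalf_id, smoothHalf_id⟩
  mul_mem' := by
    intro f g hf hg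
    exact ⟨hf.1.comp hg.1, hg.2.comp hf.2⟩
  inv_mem' := fun hf => ⟨hf.2, hf.1⟩

theorem Homeomorph.nnreal_map_zero (f : ℝ≥0 ≃ₜ ℝ≥0) : f 0 = 0 := by
  rcases f.continuous.strictMono_of_inj f.injective with h | h
  · obtain ⟨y, hy⟩ := f.surjective 0
    have := h.monotone (zero_le (a := y))
    rw [hy] at this
    exact le_antisymm this zero_le
  · obtain ⟨y, hy⟩ := f.surjective (f 0 + 1)
    have := h.antitone (zero_le (a := y))
    rw [hy] at this
    exact absurd this (not_le.2 (lt_add_of_pos_right _ one_pos))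

/-! ### The Hopf construction -/

/-- The manifold `R̃ = ℂ × [0, ∞) ∖ {(0, 0)}`, as an open subset of `ℂ × [0, ∞)`. -/
def hopfCover : TopologicalSpace.Opens LeafModel := ⟨{0}ᶜ, isOpen_compl_singleton⟩

instance : Nonempty hopfCover := ⟨⟨(1, 0), by simp [hopfCover]⟩⟩

/-- The homeomorphism `(z, x) ↦ (a z, η x)` of `R̃`, as a function of `(a, η)`. -/
def hopfProd : ℂˣ × DiffHalf →* (hopfCover ≃ₜ hopfCover) where
  toFun g :=
    { toFun := fun p => ⟨((g.1 : ℂ) * p.1.1, (g.2 : ℝ≥0 ≃ₜ ℝ≥0) p.1.2), by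
        intro h
        apply p.2
        rw [mem_singleton_iff, Prod.ext_iff] at h ⊢
        refine ⟨by simpa using h.1, (g.2 : ℝ≥0 ≃ₜ ℝ≥0).injective ?_⟩
        rw [Prod.snd_zero, Homeomorph.nnreal_map_zero]
        exact h.2⟩
      invFun := fun p => ⟨((g.1⁻¹ : ℂˣ) * p.1.1, (g.2 : ℝ≥0 ≃ₜ ℝ≥0).symm p.1.2), by
        intro h
        apply p.2
        rw [mem_singleton_iff, Prod.ext_iff] at h ⊢
        refine ⟨by simpa using h.1, (g.2 : ℝ≥0 ≃ₜ ℝ≥0).symm.injective ?_⟩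
        rw [Prod.snd_zero, Homeomorph.nnreal_map_zero]
        exact h.2⟩
      left_inv := fun p => by simp
      right_inv := fun p => by simp
      continuous_toFun := by fun_prop
      continuous_invFun := by fun_prop }
  map_one' := by
    ext p <;> simp
  map_mul' g h := by
    ext p <;> simp [mul_assoc]

theorem hopfProd_apply (g : ℂˣ × DiffHalf) (p : hopfCover) :
    (hopfProd g p : LeafModel) = ((g.1 : ℂ) * p.1.1, (g.2 : ℝ≥0 ≃ₜ ℝ≥0) p.1.2) := rfl

theorem isLeafwise_prod (g : ℂˣ × DiffHalf) (s : Set LeafModel) :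
    LeafModel.IsLeafwise (fun p => ((g.1 : ℂ) * p.1, (g.2 : ℝ≥0 ≃ₜ ℝ≥0) p.2)) s where
  smooth := by
    refine ContDiffOn.prodMk ?_ ?_
    · exact (contDiff_const.mul contDiff_fst).contDiffOn
    · refine ContDiffOn.comp (t := Ici 0) (g := fun x : ℝ => ((g.2 : ℝ≥0 ≃ₜ ℝ≥0) x.toNNReal : ℝ))
        g.2.2.1 contDiff_snd.contDiffOn ?_
      rintro _ ⟨p, -, rfl⟩
      exact p.2.2
  foliated p _ := ⟨univ, isOpen_univ, mem_univ p, fun q _ q' _ h => by simp [h]⟩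
  holomorphic p _ := by fun_prop

theorem hopfProd_mem (g : ℂˣ × DiffHalf) : hopfProd g ∈ leafAut hopfCover := by
  have key : ∀ g : ℂˣ × DiffHalf, ∀ c ∈ atlas LeafModel hopfCover,
      ∀ c' ∈ atlas LeafModel hopfCover, LeafModel.IsLeafwise
        (c.symm ≫ₕ (hopfProd g).toOpenPartialHomeomorph ≫ₕ c')
        (c.symm ≫ₕ (hopfProd g).toOpenPartialHomeomorph ≫ₕ c').source := by
    intro g c hc c' hc'
    refine (isLeafwise_prod g _).congr (OpenPartialHomeomorph.open_source _) fun p hp => ?_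
    obtain ⟨x, rfl⟩ := TopologicalSpace.Opens.chart_eq' inferInstance hc
    obtain ⟨x', rfl⟩ := TopologicalSpace.Opens.chart_eq' inferInstance hc'
    have hp' := ((chartAt LeafModel (x : LeafModel)).subtypeRestr (s := hopfCover)
      inferInstance).right_inv hp.1
    simp only [chartAt_self_eq, OpenPartialHomeomorph.subtypeRestr_coe, domRestrict_apply,
      OpenPartialHomeomorph.refl_apply] at hp'
    simp only [OpenPartialHomeomorph.coe_trans, Function.comp_apply, chartAt_self_eq,
      OpenPartialHomeomorph.subtypeRestr_coe, domRestrict_apply,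
      OpenPartialHomeomorph.refl_apply, Homeomorph.toOpenPartialHomeomorph_apply,
      hopfProd_apply]
    rw [id_eq] at hp' ⊢
    rw [hp']
  intro c hc c' hc'
  refine ⟨key g c hc c' hc', ?_⟩
  have h := key g⁻¹ c' hc' c hc
  rw [map_inv] at h
  have h2 : (c.symm ≫ₕ (hopfProd g).toOpenPartialHomeomorph ≫ₕ c').symm =
      c'.symm ≫ₕ ((hopfProd g)⁻¹).toOpenPartialHomeomorph ≫ₕ c := by
    rw [OpenPartialHomeomorph.trans_symm_eq_symm_trans_symm,
      OpenPartialHomeomorph.trans_symm_eq_symm_trans_symm, OpenPartialHomeomorph.symm_symm,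
      OpenPartialHomeomorph.trans_assoc]
    rfl
  rw [← h2] at h
  exact h

/-- The data `(λ, φ)` of the Hopf construction: `|λ| > 1` and `φ ∈ Diff^∞([0, ∞))` is expanding. -/
structure HopfData where
  lam : ℂˣ
  one_lt_norm : 1 < ‖(lam : ℂ)‖
  phi : DiffHalf
  expanding : ∀ x : ℝ≥0, 0 < x → x < (phi : ℝ≥0 ≃ₜ ℝ≥0) x

namespace HopfData

variable (D : HopfData)

/-- The automorphism `T (z, x) = (λ z, φ x)` of `R̃`. -/
def T : leafAut hopfCover := ⟨hopfProd (D.lam, D.phi), hopfProd_mem _⟩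

/-- The orbit relation of the group `T^ℤ` on `R̃`. -/
def orbitSetoid : Setoid hopfCover where
  r p q := ∃ n : ℤ, (D.T ^ n : leafAut hopfCover).1 p = q
  iseqv :=
    { refl := fun p => ⟨0, by simp⟩
      symm := by
        rintro p _ ⟨n, rfl⟩
        refine ⟨-n, ?_⟩
        rw [← Homeomorph.mul_apply, ← Subgroup.coe_mul, ← zpow_add]
        simp
      trans := by
        rintro p _ _ ⟨n, rfl⟩ ⟨m, rfl⟩
        refine ⟨m + n, ?_⟩
        rw [zpow_add, Subgroup.coe_mul, Homeomorph.mul_apply] }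

/-- The Reeb component `R = R̃ / T^ℤ`. -/
def Reeb : Type := Quotient D.orbitSetoid

instance : TopologicalSpace D.Reeb := inferInstanceAs (TopologicalSpace (Quotient D.orbitSetoid))

/-- The projection `R̃ → R`. -/
def proj (p : hopfCover) : D.Reeb := Quotient.mk D.orbitSetoid p

theorem proj_eq_iff {p q : hopfCover} :
    D.proj p = D.proj q ↔ ∃ n : ℤ, (D.T ^ n : leafAut hopfCover).1 p = q :=
  Quotient.eq (r := D.orbitSetoid)

theorem T_zpow (n : ℤ) : (D.T ^ n : leafAut hopfCover).1 = hopfProd ((D.lam, D.phi) ^ n) := by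
  rw [map_zpow]
  rfl

/-- A continuous function on `R̃` which is increased by `T`. -/
def height (p : hopfCover) : ℝ := ‖p.1.1‖ + (p.1.2 : ℝ)

theorem continuous_height : Continuous height := by
  unfold height
  fun_prop

theorem height_lt (p : hopfCover) : height p < height (D.T.1 p) := by
  have h1 : (D.T.1 p).1 = ((D.lam : ℂ) * p.1.1, (D.phi : ℝ≥0 ≃ₜ ℝ≥0) p.1.2) := rfl
  unfold height
  rw [h1]
  simp only [norm_mul]
  have hl := D.one_lt_norm
  by_cases hx : p.1.2 = 0
  · have hz : p.1.1 ≠ 0 := fun hz => p.2 (Prod.ext hz hx)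
    have : 0 < ‖p.1.1‖ := norm_pos_iff.2 hz
    rw [hx, Homeomorph.nnreal_map_zero]
    nlinarith
  · have h2 : (p.1.2 : ℝ) < (D.phi : ℝ≥0 ≃ₜ ℝ≥0) p.1.2 := by
      exact_mod_cast D.expanding _ (pos_iff_ne_zero.2 hx)
    have : 0 ≤ ‖p.1.1‖ := norm_nonneg _
    nlinarith

theorem height_pow (p : hopfCover) (n : ℕ) :
    height (D.T.1 p) ≤ height ((D.T ^ ((n : ℤ) + 1) : leafAut hopfCover).1 p) := by
  induction n with
  | zero => simp
  | succ k ih =>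
    refine ih.trans ?_
    have : (D.T ^ (((k + 1 : ℕ) : ℤ) + 1) : leafAut hopfCover) = D.T * D.T ^ ((k : ℤ) + 1) := by
      rw [← zpow_one_add]
      congr 1
      push_cast
      ring
    rw [this, Subgroup.coe_mul, Homeomorph.mul_apply]
    exact (D.height_lt _).le

/-- Every point of `R̃` has a neighbourhood that is disjoint from its translates. -/
theorem exists_wandering (p : hopfCover) : ∃ U : Set hopfCover, IsOpen U ∧ p ∈ U ∧
    ∀ q ∈ U, ∀ n : ℤ, (D.T ^ n : leafAut hopfCover).1 q ∈ U → n = 0 := by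
  obtain ⟨m, hm₁, hm₂⟩ := exists_between (D.height_lt p)
  let U : Set hopfCover := {q | height q < m ∧ m < height (D.T.1 q)}
  have pos : ∀ q ∈ U, ∀ n : ℕ, (D.T ^ ((n : ℤ) + 1) : leafAut hopfCover).1 q ∉ U := by
    intro q hq n hn
    exact absurd (hq.2.trans_le (D.height_pow q n)) (not_lt.2 hn.1.le)
  refine ⟨U, ?_, ⟨hm₁, hm₂⟩, ?_⟩
  · exact (isOpen_lt continuous_height continuous_const).inter
      (isOpen_lt continuous_const (continuous_height.comp D.T.1.continuous))
  · intro q hq n hn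
    rcases lt_trichotomy n 0 with h | h | h
    · exfalso
      obtain ⟨k, hk⟩ := Int.eq_ofNat_of_zero_le (show 0 ≤ -n - 1 by omega)
      refine pos _ hn k ?_
      rw [← hk, ← Homeomorph.mul_apply, ← Subgroup.coe_mul, ← zpow_add]
      simpa using hq
    · exact h
    · exfalso
      obtain ⟨k, hk⟩ := Int.eq_ofNat_of_zero_le (show 0 ≤ n - 1 by omega)
      refine pos q hq k ?_
      rw [← hk]
      simpa using hn

theorem continuous_proj : Continuous D.proj := continuous_quot_mk

theorem isOpenMap_proj : IsOpenMap D.proj := by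
  intro U hU
  have h : D.proj ⁻¹' (D.proj '' U) = ⋃ n : ℤ, (D.T ^ n : leafAut hopfCover).1 '' U := by
    ext q
    simp only [mem_preimage, mem_image, mem_iUnion, proj_eq_iff]
    constructor
    · rintro ⟨p, hp, n, h⟩
      exact ⟨n, p, hp, h⟩
    · rintro ⟨n, p, hp, h⟩
      exact ⟨p, hp, n, h⟩
  refine (isQuotientMap_quot_mk (X := hopfCover)).isOpen_preimage.1 ?_
  change IsOpen (D.proj ⁻¹' (D.proj '' U))
  rw [h]
  exact isOpen_iUnion fun n => (D.T ^ n : leafAut hopfCover).1.isOpenMap _ hU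

theorem isLocalHomeomorph_proj : IsLocalHomeomorph D.proj := by
  rw [isLocalHomeomorph_iff_isOpenEmbedding_restrict]
  intro p
  obtain ⟨U, hU, hpU, H⟩ := D.exists_wandering p
  refine ⟨U, hU.mem_nhds hpU, ?_⟩
  refine IsOpenEmbedding.of_continuous_injective_isOpenMap
    (D.continuous_proj.comp continuous_subtype_val) ?_
    (D.isOpenMap_proj.comp hU.isOpenMap_subtype_val)
  rintro ⟨q, hq⟩ ⟨q', hq'⟩ h
  obtain ⟨n, hn⟩ := D.proj_eq_iff.1 h
  have h0 : n = 0 := H q hq n (by rw [hn]; exact hq')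
  subst h0
  exact Subtype.ext (by simpa using hn)

/-- The foliated charts of `R` are the local inverses of the projection `R̃ → R`, followed by
the inclusion of `R̃` in `ℂ × [0, ∞)`. -/
instance : ChartedSpace LeafModel D.Reeb where
  atlas := {c | ∀ q ∈ c.source, ∃ h : c q ∈ hopfCover, D.proj ⟨c q, h⟩ = q}
  chartAt q := D.isLocalHomeomorph_proj.localInverseAt q.out ≫ₕ
    hopfCover.openPartialHomeomorphSubtypeCoe inferInstance
  mem_chart_source q := by
    have h : D.proj q.out = q := Quotient.out_eq q
    have h2 := D.isLocalHomeomorph_proj.apply_self_mem_localInverseAt_source (x := q.out)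
    rw [h] at h2
    exact ⟨h2, mem_univ _⟩
  chart_mem_atlas q := by
    intro q' hq'
    exact ⟨(D.isLocalHomeomorph_proj.localInverseAt q.out q').2,
      D.isLocalHomeomorph_proj.apply_localInverseAt_of_mem hq'.1⟩

/-- `R` is a manifold with boundary with a foliation with complex leaves. -/
instance : HasGroupoid D.Reeb LeafModel.groupoid where
  compatible := by
    have key : ∀ c ∈ atlas LeafModel D.Reeb, ∀ c' ∈ atlas LeafModel D.Reeb,
        LeafModel.IsLeafwise (c.symm ≫ₕ c') (c.symm ≫ₕ c').source := by
      intro c hc c' hc'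
      refine LeafModel.pregroupoid.locality (OpenPartialHomeomorph.open_source _) fun p hp => ?_
      have lift : ∀ q ∈ (c.symm ≫ₕ c').source, ∃ (h : q ∈ hopfCover)
          (h' : (c.symm ≫ₕ c') q ∈ hopfCover), D.proj ⟨q, h⟩ = D.proj ⟨(c.symm ≫ₕ c') q, h'⟩ := by
        intro q hq
        obtain ⟨h, e⟩ := hc (c.symm q) (c.map_target hq.1)
        obtain ⟨h', e'⟩ := hc' (c.symm q) hq.2
        have hcq : c (c.symm q) = q := c.right_inv hq.1
        refine ⟨hcq ▸ h, h', ?_⟩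
        have : (⟨q, hcq ▸ h⟩ : hopfCover) = ⟨c (c.symm q), h⟩ := Subtype.ext hcq.symm
        rw [this, e]
        exact e'.symm
      obtain ⟨h, h', e⟩ := lift p hp
      obtain ⟨n, hn⟩ := D.proj_eq_iff.1 e
      obtain ⟨U, hU, hpU, H⟩ := D.exists_wandering ⟨p, h⟩
      let g := (D.lam, D.phi) ^ n
      have hTg := D.T_zpow n
      -- the translate of `U` by `T ^ n` and its image in the model
      let V : Set LeafModel := Subtype.val '' U
      let W : Set LeafModel := Subtype.val '' ((D.T ^ n : leafAut hopfCover).1 '' U)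
      have hV : IsOpen V := hopfCover.isOpen.isOpenMap_subtype_val _ hU
      have hW : IsOpen W := hopfCover.isOpen.isOpenMap_subtype_val _
        ((D.T ^ n : leafAut hopfCover).1.isOpenMap _ hU)
      have hO : IsOpen ((c.symm ≫ₕ c').source ∩ (c.symm ≫ₕ c') ⁻¹' W) :=
        (c.symm ≫ₕ c').continuousOn_toFun.isOpen_inter_preimage
          (OpenPartialHomeomorph.open_source _) hW
      refine ⟨V ∩ ((c.symm ≫ₕ c').source ∩ (c.symm ≫ₕ c') ⁻¹' W), hV.inter hO,
        ⟨⟨_, hpU, rfl⟩, hp, ⟨_, ⟨_, hpU, rfl⟩, by rw [hn]⟩⟩, ?_⟩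
      refine (isLeafwise_prod g _).congr
        ((OpenPartialHomeomorph.open_source _).inter (hV.inter hO)) ?_
      rintro q ⟨hq, ⟨r, hr, hrq⟩, -, ⟨_, ⟨s, hs, rfl⟩, hsq⟩⟩
      obtain ⟨k, k', e⟩ := lift q hq
      have hrq' : (⟨q, k⟩ : hopfCover) = r := Subtype.ext hrq.symm
      have hsq' : (⟨(c.symm ≫ₕ c') q, k'⟩ : hopfCover) = (D.T ^ n : leafAut hopfCover).1 s :=
        Subtype.ext hsq.symm
      rw [hrq', hsq'] at e
      have e2 : D.proj r = D.proj s := e.trans (D.proj_eq_iff.2 ⟨n, rfl⟩).symm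
      obtain ⟨m, hm⟩ := D.proj_eq_iff.1 e2
      have hm0 : m = 0 := H r hr m (by rw [hm]; exact hs)
      subst hm0
      have hrs : r = s := by simpa using hm
      rw [← hsq, ← hrs, hTg, hopfProd_apply, hrq]
    intro c c' hc hc'
    refine ⟨key c hc c' hc', ?_⟩
    have h := key c' hc' c hc
    have h2 : (c.symm ≫ₕ c').symm = c'.symm ≫ₕ c := by
      rw [OpenPartialHomeomorph.trans_symm_eq_symm_trans_symm, OpenPartialHomeomorph.symm_symm]
    rw [← h2] at h
    exact h

/-- The group `Aut(R̃; T)`: the centralizer of `T` in `Aut R̃`. -/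
abbrev AutT : Subgroup (leafAut hopfCover) := Subgroup.centralizer {D.T}

theorem T_mem : D.T ∈ D.AutT := Subgroup.mem_centralizer_singleton_iff.2 rfl

/-- The subgroup `T^ℤ` of `Aut(R̃; T)`. -/
abbrev zpowersT : Subgroup D.AutT := Subgroup.zpowers ⟨D.T, D.T_mem⟩

theorem normal_of_le_center {G : Type} [Group G] {H : Subgroup G} (h : H ≤ Subgroup.center G) :
    H.Normal where
  conj_mem n hn g := by
    rw [Subgroup.mem_center_iff.1 (h hn) g, mul_inv_cancel_right]
    exact hn

instance : D.zpowersT.Normal := by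
  refine normal_of_le_center ?_
  rw [Subgroup.zpowers_le, Subgroup.mem_center_iff]
  intro g
  exact Subtype.ext (Subgroup.mem_centralizer_singleton_iff.1 g.2)

/-- The centralizer `Z_φ` of `φ` in `Diff^∞([0, ∞))`. -/
abbrev Z : Subgroup DiffHalf := Subgroup.centralizer {D.phi}

theorem phi_mem : D.phi ∈ D.Z := Subgroup.mem_centralizer_singleton_iff.2 rfl

/-- The subgroup `(λ, φ)^ℤ` of `ℂ* × Z_φ`. -/
abbrev zpowersLamPhi : Subgroup (ℂˣ × D.Z) := Subgroup.zpowers (D.lam, ⟨D.phi, D.phi_mem⟩)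

instance : D.zpowersLamPhi.Normal := by
  refine normal_of_le_center ?_
  rw [Subgroup.zpowers_le, Subgroup.mem_center_iff]
  intro g
  exact Prod.ext (mul_comm _ _) (Subtype.ext (Subgroup.mem_centralizer_singleton_iff.1 g.2.2))

/-- The vector space `𝒦_{λ,φ}` of smooth functions `b : [0, ∞) → ℂ` with `b ∘ φ = λ b`. -/
def K : Submodule ℂ (ℝ≥0 → ℂ) where
  carrier := {b | SmoothHalf b ∧ ∀ x, b ((D.phi : ℝ≥0 ≃ₜ ℝ≥0) x) = D.lam * b x}
  zero_mem' := ⟨contDiffOn_const, by simp⟩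
  add_mem' := by
    intro b c hb hc
    refine ⟨ContDiffOn.add hb.1 hc.1, fun x => ?_⟩
    simp [hb.2 x, hc.2 x, mul_add]
  smul_mem' := by
    intro a b hb
    refine ⟨ContDiffOn.const_smul a hb.1, fun x => ?_⟩
    simp [hb.2 x, mul_left_comm]

end HopfData

end

noncomputable section

/-! ### Topology of the cover -/

/-! The cover `R̃` is contractible and `T` acts on it with wandering neighbourhoods, so `R̃ → R` is
a universal covering with deck group `T^ℤ`. A homeomorphism of `R` therefore lifts, and a lift
conjugates `T` to `T` or `T⁻¹`. The second case is impossible for an automorphism: it acts on the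
leaf space by an increasing map, and `φ` is expanding. Since being an automorphism is a condition on
germs, it passes between `R` and `R̃`, which gives (i).

An automorphism commuting with `T` has the form `(a z + b(x), η(x))` (`exists_affine`). Equivariance
forces linear growth on each leaf, so the map is affine in `z` for `x > 0`. Its leading coefficient
is `φ`-invariant and continuous at `0`, to which the backward orbits of `φ` converge, so it is
constant. Equivariance then says `b ∘ φ = λ b` and `η ∈ Z_φ`. Translations and diagonal maps thus
generate the group, and they meet trivially.

Conjugation by diagonal maps yields `b ↦ a⁻¹ (b ∘ η)`, which a priori reverses products. That it is
an action rests on `Z_φ` being commutative (`Z_mul_comm`). By Kopell's lemma (`eq_one_of_fixed`)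
`Z_φ` acts freely on `(0, ∞)`; hence evaluation at `1` gives a bi-invariant Archimedean order, and
Hölder's theorem (`commute_of_archimedean`) applies. -/

instance : LocallyPathConnectedSpace LeafModel := by
  have h : IsQuotientMap LeafModel.retr :=
    IsQuotientMap.of_inverse LeafModel.continuous_incl LeafModel.continuous_retr
      LeafModel.retr_incl
  exact h.locallyPathConnectedSpace

instance : LocallyPathConnectedSpace hopfCover :=
  hopfCover.isOpen.locallyPathConnectedSpace

/-- `R̃` is star-shaped about `(0, 1)`. -/
instance : ContractibleSpace hopfCover := by
  rw [contractible_iff_id_nullhomotopic]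
  -- For `t > 0` the second coordinate is positive, so the segment to `(0, 1)` avoids the deleted
  -- point.
  have hmem : ∀ (t : unitInterval) (p : hopfCover),
      (((1 - t : ℝ) : ℂ) * p.1.1, Real.toNNReal (1 - t) * p.1.2 + Real.toNNReal t) ∈
        hopfCover := by
    intro t p h
    simp only [mem_singleton_iff, Prod.ext_iff, Prod.fst_zero, Prod.snd_zero, add_eq_zero] at h
    obtain ⟨h1, h2, h3⟩ := h
    have ht : (t : ℝ) = 0 := le_antisymm (Real.toNNReal_eq_zero.1 h3) t.2.1
    have ht' : t = 0 := Subtype.ext ht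
    subst ht'
    apply p.2
    refine Prod.ext ?_ ?_
    · simpa using h1
    · simpa using h2
  refine ⟨⟨(0, 1), by simp [hopfCover]⟩, ⟨⟨⟨fun q => ⟨_, hmem q.1 q.2⟩, ?_⟩, ?_, ?_⟩⟩⟩
  · fun_prop
  · intro p
    ext <;> simp
  · intro p
    ext <;> simp

/-! ### Covering theory of the projection and lifts of homeomorphisms. -/

namespace HopfData

variable (D : HopfData)

theorem isCoveringMap_proj : IsCoveringMap D.proj := by
  let _ : AddAction ℤ hopfCover :=
    { vadd := fun n p => (D.T ^ n : leafAut hopfCover).1 p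
      zero_vadd := fun p => by
        change (D.T ^ (0 : ℤ) : leafAut hopfCover).1 p = p
        simp
      add_vadd := fun m n p => by
        change (D.T ^ (m + n) : leafAut hopfCover).1 p = _
        rw [zpow_add, Subgroup.coe_mul, Homeomorph.mul_apply]
        rfl }
  have h : IsAddQuotientCoveringMap D.proj ℤ :=
    { toIsQuotientMap := isQuotientMap_quot_mk
      continuous_const_vadd := fun n => (D.T ^ n : leafAut hopfCover).1.continuous
      apply_eq_iff_mem_orbit := by
        intro p q
        rw [eq_comm, D.proj_eq_iff]
        rfl
      disjoint := by
        intro p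
        obtain ⟨U, hU, hpU, H⟩ := D.exists_wandering p
        refine ⟨U, hU.mem_nhds hpU, ?_⟩
        rintro n ⟨_, ⟨q, hq, rfl⟩, hq'⟩
        exact H q hq n hq' }
  exact h.isCoveringMap

theorem proj_surjective : Function.Surjective D.proj := Quotient.mk_surjective

theorem proj_T_zpow (n : ℤ) (p : hopfCover) :
    D.proj ((D.T ^ n : leafAut hopfCover).1 p) = D.proj p :=
  (D.proj_eq_iff.2 ⟨n, rfl⟩).symm

theorem T_zpow_injective (p : hopfCover) {m n : ℤ}
    (h : (D.T ^ m : leafAut hopfCover).1 p = (D.T ^ n : leafAut hopfCover).1 p) : m = n := by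
  obtain ⟨U, -, hpU, H⟩ := D.exists_wandering p
  have h2 : (D.T ^ (m - n) : leafAut hopfCover).1 p = p := by
    rw [sub_eq_neg_add, zpow_add, Subgroup.coe_mul, Homeomorph.mul_apply, h,
      ← Homeomorph.mul_apply, ← Subgroup.coe_mul, ← zpow_add]
    simp
  have := H p hpU (m - n) (by rw [h2]; exact hpU)
  omega

/-- Two lifts of a map that is defined on `R̃` differ by a power of `T`. -/
theorem exists_eq_T_zpow_of_proj_eq {u v : hopfCover → hopfCover} (hu : Continuous u)
    (hv : Continuous v) (h : ∀ p, D.proj (u p) = D.proj (v p)) :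
    ∃ n : ℤ, ∀ p, v p = (D.T ^ n : leafAut hopfCover).1 (u p) := by
  let p₀ : hopfCover := Classical.arbitrary _
  obtain ⟨n, hn⟩ := D.proj_eq_iff.1 (h p₀)
  refine ⟨n, congrFun ?_⟩
  -- After correction by `T ^ n` the two lifts agree at `p₀`, hence everywhere because `R̃` is
  -- connected.
  refine D.isCoveringMap_proj.eq_of_comp_eq hv
    ((D.T ^ n : leafAut hopfCover).1.continuous.comp hu) ?_ p₀ hn.symm
  funext p
  simp only [Function.comp_apply]
  rw [D.proj_T_zpow, h]

/-- Every homeomorphism of `R` lifts to `R̃`. -/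
theorem exists_lift (f : D.Reeb ≃ₜ D.Reeb) :
    ∃ g : hopfCover ≃ₜ hopfCover, ∀ p, D.proj (g p) = f (D.proj p) := by
  have cov := D.isCoveringMap_proj
  let p₀ : hopfCover := Classical.arbitrary _
  obtain ⟨q₀, hq₀⟩ := D.proj_surjective (f (D.proj p₀))
  obtain ⟨F, ⟨hF0, hF⟩, -⟩ := cov.existsUnique_continuousMap_lifts
    ⟨fun p => f (D.proj p), f.continuous.comp D.continuous_proj⟩ p₀ q₀ hq₀
  -- The base points are exchanged, so that both composites of `F` and `G` lift `proj` and fix a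
  -- point; uniqueness of lifts makes them the identity.
  obtain ⟨G, ⟨hG0, hG⟩, -⟩ := cov.existsUnique_continuousMap_lifts
    ⟨fun p => f.symm (D.proj p), f.symm.continuous.comp D.continuous_proj⟩ q₀ p₀
      (by simp [hq₀])
  have hFproj : ∀ p, D.proj (F p) = f (D.proj p) := congrFun hF
  have hGproj : ∀ p, D.proj (G p) = f.symm (D.proj p) := congrFun hG
  have h1 : G ∘ F = id := cov.eq_of_comp_eq (G.continuous.comp F.continuous) continuous_id
    (funext fun p => by simp [hFproj, hGproj]) p₀ (by simp [hF0, hG0])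
  have h2 : F ∘ G = id := cov.eq_of_comp_eq (F.continuous.comp G.continuous) continuous_id
    (funext fun p => by simp [hFproj, hGproj]) q₀ (by simp [hF0, hG0])
  exact ⟨⟨⟨F, G, congrFun h1, congrFun h2⟩, F.continuous, G.continuous⟩, hFproj⟩

/-- A lift of a homeomorphism of `R` conjugates `T` to itself or to its inverse. -/
theorem lift_conj_T {f : D.Reeb ≃ₜ D.Reeb} {g : hopfCover ≃ₜ hopfCover}
    (h : ∀ p, D.proj (g p) = f (D.proj p)) :
    (∀ p, g (D.T.1 p) = D.T.1 (g p)) ∨ (∀ p, g p = D.T.1 (g (D.T.1 p))) := by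
  have hT : ∀ p, D.proj (D.T.1 p) = D.proj p := fun p => by simpa using D.proj_T_zpow 1 p
  have h' : ∀ p, D.proj (g.symm p) = f.symm (D.proj p) := fun p => by
    rw [Homeomorph.eq_symm_apply, ← h, g.apply_symm_apply]
  -- `g` and `g ∘ T` lift the same map, so `g ∘ T = T ^ k ∘ g`; likewise with exponent `l` for
  -- `g.symm`. Freeness of the action then forces `k * l = 1`.
  obtain ⟨k, hk⟩ := D.exists_eq_T_zpow_of_proj_eq g.continuous
    (g.continuous.comp D.T.1.continuous) (fun p => by simp [h, hT])
  obtain ⟨l, hl⟩ := D.exists_eq_T_zpow_of_proj_eq g.symm.continuous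
    (g.symm.continuous.comp D.T.1.continuous) (fun p => by simp [h', hT])
  simp only [Function.comp_apply] at hk hl
  have hkn : ∀ (n : ℤ) p, g ((D.T ^ n : leafAut hopfCover).1 p) =
      (D.T ^ (k * n) : leafAut hopfCover).1 (g p) := by
    intro n
    induction n using Int.induction_on with
    | zero => simp
    | succ n ih =>
      intro p
      have e1 : (D.T ^ ((n : ℤ) + 1) : leafAut hopfCover) = D.T * D.T ^ (n : ℤ) := by
        rw [← zpow_one_add, add_comm]
      have e2 : (D.T ^ (k * ((n : ℤ) + 1)) : leafAut hopfCover) =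
          D.T ^ k * D.T ^ (k * (n : ℤ)) := by
        rw [← zpow_add]; congr 1; ring
      rw [e1, e2, Subgroup.coe_mul, Subgroup.coe_mul, Homeomorph.mul_apply, Homeomorph.mul_apply,
        hk, ih]
    | pred n ih =>
      intro p
      have e2 : (D.T ^ (k * (-(n : ℤ) - 1)) : leafAut hopfCover) =
          (D.T ^ k)⁻¹ * D.T ^ (k * (-(n : ℤ))) := by
        rw [← zpow_neg, ← zpow_add]; congr 1; ring
      have e1 : (D.T ^ (-(n : ℤ)) : leafAut hopfCover) = D.T * D.T ^ (-(n : ℤ) - 1) := by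
        rw [← zpow_one_add]; congr 1; ring
      have := ih p
      rw [e1, Subgroup.coe_mul, Homeomorph.mul_apply, hk] at this
      rw [e2, Subgroup.coe_mul, Homeomorph.mul_apply, ← this]
      exact (Homeomorph.symm_apply_apply _ _).symm
  let p₀ : hopfCover := Classical.arbitrary _
  have hkl : (1 : ℤ) = k * l := by
    refine D.T_zpow_injective p₀ ?_
    have := hl p₀
    rw [Homeomorph.symm_apply_eq, hkn, g.apply_symm_apply] at this
    simpa using this
  rcases Int.eq_one_or_neg_one_of_mul_eq_one hkl.symm with rfl | rfl
  · left
    intro p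
    simpa using hk p
  · right
    intro p
    rw [hk p, ← Homeomorph.mul_apply, ← Subgroup.coe_mul]
    simp

end HopfData

end

noncomputable section

/-! ### Germs of leafwise holomorphic foliated maps -/

namespace LeafModel

/-- `F` is a leafwise holomorphic foliated map near `p`. -/
def LeafwiseAt (F : LeafModel → LeafModel) (p : LeafModel) : Prop :=
  ∃ u, IsOpen u ∧ p ∈ u ∧ IsLeafwise F u

variable {F G : LeafModel → LeafModel} {p : LeafModel} {s : Set LeafModel}

theorem IsLeafwise.continuousOn (h : IsLeafwise F s) : ContinuousOn F s := by
  have h2 : ContinuousOn (retr ∘ (incl ∘ F ∘ retr) ∘ incl) s :=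
    continuous_retr.comp_continuousOn
      (h.smooth.continuousOn.comp continuous_incl.continuousOn (mapsTo_image _ _))
  have h3 : retr ∘ (incl ∘ F ∘ retr) ∘ incl = F := by
    funext q
    simp [retr_incl]
  rwa [h3] at h2

theorem LeafwiseAt.continuousAt (h : LeafwiseAt F p) : ContinuousAt F p := by
  obtain ⟨u, hu, hp, h⟩ := h
  exact h.continuousOn.continuousAt (hu.mem_nhds hp)

theorem LeafwiseAt.congr (h : LeafwiseAt F p) (e : G =ᶠ[𝓝 p] F) : LeafwiseAt G p := by
  obtain ⟨u, hu, hp, h⟩ := h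
  obtain ⟨v, hv, hvo, hpv⟩ := mem_nhds_iff.1 e
  exact ⟨u ∩ v, hu.inter hvo, ⟨hp, hpv⟩,
    (h.mono inter_subset_left).congr (hu.inter hvo) fun q hq => hv hq.2⟩

theorem LeafwiseAt.comp (hG : LeafwiseAt G (F p)) (hF : LeafwiseAt F p) :
    LeafwiseAt (G ∘ F) p := by
  obtain ⟨u, hu, hp, hF⟩ := hF
  obtain ⟨v, hv, hpv, hG⟩ := hG
  have ho : IsOpen (u ∩ F ⁻¹' v) := hF.continuousOn.isOpen_inter_preimage hu hv
  exact ⟨u ∩ F ⁻¹' v, ho, ⟨hp, hpv⟩, pregroupoid.comp hF hG hu hv ho⟩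

theorem isLeafwise_iff_forall_leafwiseAt (hs : IsOpen s) :
    IsLeafwise F s ↔ ∀ p ∈ s, LeafwiseAt F p := by
  refine ⟨fun h p hp => ⟨s, hs, hp, h⟩, fun h => pregroupoid.locality hs fun p hp => ?_⟩
  obtain ⟨u, hu, hpu, h⟩ := h p hp
  exact ⟨u, hu, hpu, h.mono inter_subset_right⟩

theorem leafwiseAt_prod (g : ℂˣ × DiffHalf) (p : LeafModel) :
    LeafwiseAt (fun p => ((g.1 : ℂ) * p.1, (g.2 : ℝ≥0 ≃ₜ ℝ≥0) p.2)) p :=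
  ⟨univ, isOpen_univ, mem_univ p, isLeafwise_prod g _⟩

end LeafModel

open LeafModel

/-- Membership in the groupoid is a condition on germs of chart expressions. The inverse of such an
expression is the one for `f.symm` with the two charts exchanged. -/
theorem mem_leafAut_iff {M : Type} [TopologicalSpace M] [ChartedSpace LeafModel M]
    [HasGroupoid M LeafModel.groupoid] {f : M ≃ₜ M} :
    f ∈ leafAut M ↔ ∀ c ∈ atlas LeafModel M, ∀ c' ∈ atlas LeafModel M,
      (∀ q ∈ c.target, f (c.symm q) ∈ c'.source → LeafwiseAt (c' ∘ f ∘ c.symm) q) ∧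
      (∀ q ∈ c.target, f.symm (c.symm q) ∈ c'.source → LeafwiseAt (c' ∘ f.symm ∘ c.symm) q) := by
  have key : ∀ (f : M ≃ₜ M) (c c' : OpenPartialHomeomorph M LeafModel),
      IsLeafwise (c.symm ≫ₕ f.toOpenPartialHomeomorph ≫ₕ c')
        (c.symm ≫ₕ f.toOpenPartialHomeomorph ≫ₕ c').source ↔
      ∀ q ∈ c.target, f (c.symm q) ∈ c'.source → LeafwiseAt (c' ∘ f ∘ c.symm) q := by
    intro f c c'
    rw [isLeafwise_iff_forall_leafwiseAt (OpenPartialHomeomorph.open_source _)]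
    constructor
    · exact fun h q hq hq' => h q ⟨hq, mem_univ _, hq'⟩
    · exact fun h q hq => h q hq.1 hq.2.2
  have hsymm : ∀ c c' : OpenPartialHomeomorph M LeafModel,
      (c.symm ≫ₕ f.toOpenPartialHomeomorph ≫ₕ c').symm =
        c'.symm ≫ₕ f.symm.toOpenPartialHomeomorph ≫ₕ c := by
    intro c c'
    rw [OpenPartialHomeomorph.trans_symm_eq_symm_trans_symm,
      OpenPartialHomeomorph.trans_symm_eq_symm_trans_symm, OpenPartialHomeomorph.symm_symm,
      OpenPartialHomeomorph.trans_assoc]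
    rfl
  constructor
  · intro h c hc c' hc'
    refine ⟨(key f c c').1 (h c hc c' hc').1, ?_⟩
    have h2 := (h c' hc' c hc).2
    rw [← OpenPartialHomeomorph.symm_source, hsymm] at h2
    exact (key f.symm c c').1 h2
  · intro h c hc c' hc'
    refine ⟨(key f c c').2 (h c hc c' hc').1, ?_⟩
    have h2 := (key f.symm c' c).2 (h c' hc' c hc).2
    rw [← hsymm] at h2
    exact h2

/-! ### Automorphisms of the cover -/

open Classical in
/-- A left inverse of the inclusion of `R̃` in `ℂ × [0, ∞)`. -/
def toHopfCover (p : LeafModel) : hopfCover :=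
  if h : p ∈ hopfCover then ⟨p, h⟩ else Classical.arbitrary _

theorem toHopfCover_of_mem {p : LeafModel} (h : p ∈ hopfCover) : toHopfCover p = ⟨p, h⟩ :=
  dif_pos h

@[simp]
theorem toHopfCover_coe (p : hopfCover) : toHopfCover p = p := toHopfCover_of_mem p.2

theorem continuousAt_toHopfCover {p : LeafModel} (hp : p ∈ hopfCover) :
    ContinuousAt toHopfCover p := by
  rw [IsInducing.subtypeVal.continuousAt_iff]
  refine continuousAt_id.congr ?_
  filter_upwards [hopfCover.isOpen.mem_nhds hp] with q hq
  simp [toHopfCover_of_mem hq]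

/-- Every chart of `R̃` is a restriction of the inclusion, so the charts can be dropped. The
arbitrary values of `toHopfCover` off `R̃` do not matter, since only germs at points of an open set
occur. -/
theorem mem_leafAut_hopfCover_iff {g : hopfCover ≃ₜ hopfCover} :
    g ∈ leafAut hopfCover ↔ ∀ p ∈ hopfCover,
      LeafwiseAt (fun q => (g (toHopfCover q) : LeafModel)) p ∧
      LeafwiseAt (fun q => (g.symm (toHopfCover q) : LeafModel)) p := by
  have hc_apply : ∀ c ∈ atlas LeafModel hopfCover, ∀ q : hopfCover, c q = q := by
    intro c hc q
    obtain ⟨x, rfl⟩ := TopologicalSpace.Opens.chart_eq' inferInstance hc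
    rfl
  have hc_symm : ∀ c ∈ atlas LeafModel hopfCover, ∀ q ∈ c.target, c.symm q = toHopfCover q := by
    intro c hc q hq
    have h := hc_apply c hc (c.symm q)
    rw [c.right_inv hq] at h
    conv_rhs => rw [h]
    rw [toHopfCover_coe]
  have key : ∀ (g : hopfCover ≃ₜ hopfCover), ∀ c ∈ atlas LeafModel hopfCover,
      ∀ c' ∈ atlas LeafModel hopfCover, ∀ q ∈ c.target,
      (c' ∘ g ∘ c.symm) =ᶠ[𝓝 q] fun q => (g (toHopfCover q) : LeafModel) := by
    intro g c hc c' hc' q hq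
    filter_upwards [c.open_target.mem_nhds hq] with r hr
    simp only [Function.comp_apply]
    rw [hc_apply c' hc', hc_symm c hc r hr]
  rw [mem_leafAut_iff]
  constructor
  · intro h p hp
    let c := chartAt LeafModel (⟨p, hp⟩ : hopfCover)
    have hc : c ∈ atlas LeafModel hopfCover := chart_mem_atlas _ _
    have hpc : p ∈ c.target := by
      have := c.map_source (mem_chart_source LeafModel (⟨p, hp⟩ : hopfCover))
      rwa [hc_apply c hc] at this
    refine ⟨?_, ?_⟩
    · refine ((h c hc (chartAt LeafModel (g (c.symm p))) (chart_mem_atlas _ _)).1 p hpc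
        (mem_chart_source _ _)).congr (key g c hc _ (chart_mem_atlas _ _) p hpc).symm
    · refine ((h c hc (chartAt LeafModel (g.symm (c.symm p))) (chart_mem_atlas _ _)).2 p hpc
        (mem_chart_source _ _)).congr (key g.symm c hc _ (chart_mem_atlas _ _) p hpc).symm
  · intro h c hc c' hc'
    have hmem : ∀ q ∈ c.target, q ∈ hopfCover := by
      intro q hq
      rw [← c.right_inv hq, hc_apply c hc]
      exact (c.symm q).2
    exact ⟨fun q hq _ => (h q (hmem q hq)).1.congr (key g c hc c' hc' q hq),
      fun q hq _ => (h q (hmem q hq)).2.congr (key g.symm c hc c' hc' q hq)⟩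

/-! ### Automorphisms of the quotient -/

namespace HopfData

variable (D : HopfData)

/-- A chart is a local section of the projection, so `c ∘ proj` moves each point by some power of
`T`. The exponent is locally constant because nearby values stay in one wandering neighbourhood. -/
theorem exists_chart_eq_T_zpow {c : OpenPartialHomeomorph D.Reeb LeafModel}
    (hc : c ∈ atlas LeafModel D.Reeb) {p : hopfCover} (hp : D.proj p ∈ c.source) :
    ∃ n : ℤ, ∀ᶠ q in 𝓝 p, c (D.proj q) = ((D.T ^ n : leafAut hopfCover).1 q : LeafModel) := by
  obtain ⟨hcp, e⟩ := hc _ hp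
  obtain ⟨n, hn⟩ := D.proj_eq_iff.1 e.symm
  refine ⟨n, ?_⟩
  obtain ⟨U, hU, hpU, H⟩ := D.exists_wandering ⟨c (D.proj p), hcp⟩
  have hcont : ContinuousAt (fun q => c (D.proj q)) p :=
    ContinuousAt.comp (f := D.proj) (c.continuousAt hp) D.continuous_proj.continuousAt
  have h1 : ∀ᶠ q in 𝓝 p, c (D.proj q) ∈ Subtype.val '' U :=
    hcont.eventually_mem ((hopfCover.isOpen.isOpenMap_subtype_val _ hU).mem_nhds ⟨_, hpU, rfl⟩)
  have h2 : ∀ᶠ q in 𝓝 p, (D.T ^ n : leafAut hopfCover).1 q ∈ U :=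
    (D.T ^ n : leafAut hopfCover).1.continuous.continuousAt.eventually_mem
      (hU.mem_nhds (by rw [hn]; exact hpU))
  have h3 : ∀ᶠ q in 𝓝 p, D.proj q ∈ c.source :=
    D.continuous_proj.continuousAt.eventually_mem (c.open_source.mem_nhds hp)
  filter_upwards [h1, h2, h3] with q hq1 hq2 hq3
  obtain ⟨r, hr, hrq⟩ := hq1
  obtain ⟨hcq, e'⟩ := hc _ hq3
  have hr' : D.proj r = D.proj q := by
    rw [← e']
    congr 1
    exact Subtype.ext hrq
  obtain ⟨m, hm⟩ := D.proj_eq_iff.1 ((D.proj_T_zpow n q).trans hr'.symm)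
  have hm0 := H _ hq2 m (by rw [hm]; exact hr)
  subst hm0
  rw [← hrq, ← hm]
  simp

/-- The local inverse of the projection through `p` is a chart for which the power of `T` above is
trivial. -/
theorem exists_chart_eq_self (p : hopfCover) :
    ∃ c ∈ atlas LeafModel D.Reeb, D.proj p ∈ c.source ∧ (p : LeafModel) ∈ c.target ∧
      ∀ᶠ q in 𝓝 p, c (D.proj q) = (q : LeafModel) := by
  let c : OpenPartialHomeomorph D.Reeb LeafModel := D.isLocalHomeomorph_proj.localInverseAt p ≫ₕ
    hopfCover.openPartialHomeomorphSubtypeCoe inferInstance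
  have hc : c ∈ atlas LeafModel D.Reeb := fun q' hq' =>
    ⟨(D.isLocalHomeomorph_proj.localInverseAt p q').2,
      D.isLocalHomeomorph_proj.apply_localInverseAt_of_mem hq'.1⟩
  have hp : D.proj p ∈ c.source :=
    ⟨D.isLocalHomeomorph_proj.apply_self_mem_localInverseAt_source, mem_univ _⟩
  have hcp : c (D.proj p) = p :=
    congrArg Subtype.val (D.isLocalHomeomorph_proj.localInverseAt_apply_self)
  refine ⟨c, hc, hp, ?_, ?_⟩
  · rw [← hcp]
    exact c.map_source hp
  · obtain ⟨n, hn⟩ := D.exists_chart_eq_T_zpow hc hp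
    have h0 : n = 0 := by
      refine D.T_zpow_injective p ?_
      refine Subtype.ext ?_
      rw [← hn.self_of_nhds, hcp]
      simp
    subst h0
    simpa using hn

/-- A homeomorphism of `R` is an automorphism if and only if a lift to `R̃` is one. -/
theorem mem_leafAut_reeb_iff {f : D.Reeb ≃ₜ D.Reeb} {g : hopfCover ≃ₜ hopfCover}
    (h : ∀ p, D.proj (g p) = f (D.proj p)) : f ∈ leafAut D.Reeb ↔ g ∈ leafAut hopfCover := by
  have h' : ∀ p, D.proj (g.symm p) = f.symm (D.proj p) := fun p => by
    rw [Homeomorph.eq_symm_apply, ← h, g.apply_symm_apply]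
  have hc_symm : ∀ c ∈ atlas LeafModel D.Reeb, ∀ q ∈ c.target,
      q ∈ hopfCover ∧ c.symm q = D.proj (toHopfCover q) := by
    intro c hc q hq
    obtain ⟨h1, h2⟩ := hc _ (c.map_target hq)
    have hcq := c.right_inv hq
    have h3 : q ∈ hopfCover := by rwa [hcq] at h1
    refine ⟨h3, ?_⟩
    rw [← h2, toHopfCover_of_mem h3]
    congr 1
    exact Subtype.ext hcq
  have down : ∀ (f : D.Reeb ≃ₜ D.Reeb) (g : hopfCover ≃ₜ hopfCover),
      (∀ p, D.proj (g p) = f (D.proj p)) → ∀ c ∈ atlas LeafModel D.Reeb,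
      ∀ c' ∈ atlas LeafModel D.Reeb, ∀ q ∈ c.target, f (c.symm q) ∈ c'.source →
      LeafwiseAt (fun q => (g (toHopfCover q) : LeafModel)) q →
      LeafwiseAt (c' ∘ f ∘ c.symm) q := by
    intro f g h c hc c' hc' q hq hq' hg
    obtain ⟨hqm, hqs⟩ := hc_symm c hc q hq
    rw [hqs, ← h] at hq'
    obtain ⟨n, hn⟩ := D.exists_chart_eq_T_zpow hc' hq'
    -- In charts `f` reads as `T ^ n ∘ g`, and `T ^ n` is itself leafwise holomorphic.
    refine (LeafwiseAt.comp (leafwiseAt_prod ((D.lam, D.phi) ^ n) _) hg).congr ?_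
    have hcont : ContinuousAt (fun r => g (toHopfCover r)) q :=
      ContinuousAt.comp (f := toHopfCover) g.continuous.continuousAt
        (continuousAt_toHopfCover hqm)
    filter_upwards [c.open_target.mem_nhds hq, hcont.eventually hn] with r hr hr'
    simp only [Function.comp_apply]
    rw [(hc_symm c hc r hr).2, ← h, hr', D.T_zpow, hopfProd_apply]
  have up : ∀ (f : D.Reeb ≃ₜ D.Reeb) (g : hopfCover ≃ₜ hopfCover),
      (∀ p, D.proj (g p) = f (D.proj p)) → (∀ c ∈ atlas LeafModel D.Reeb,
      ∀ c' ∈ atlas LeafModel D.Reeb, ∀ q ∈ c.target, f (c.symm q) ∈ c'.source →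
      LeafwiseAt (c' ∘ f ∘ c.symm) q) → ∀ p ∈ hopfCover,
      LeafwiseAt (fun q => (g (toHopfCover q) : LeafModel)) p := by
    intro f g h H p hp
    -- With charts adapted to `p` and to its image, the chart expression of `f` is `g` itself.
    obtain ⟨c, hc, -, hpt, -⟩ := D.exists_chart_eq_self ⟨p, hp⟩
    obtain ⟨c', hc', hgs, -, hgc⟩ := D.exists_chart_eq_self (g ⟨p, hp⟩)
    have hps := (hc_symm c hc p hpt).2
    rw [toHopfCover_of_mem hp] at hps
    refine (H c hc c' hc' p hpt (by rw [hps, ← h]; exact hgs)).congr ?_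
    rw [← toHopfCover_of_mem hp] at hgc
    have hcont : ContinuousAt (fun r => g (toHopfCover r)) p :=
      ContinuousAt.comp (f := toHopfCover) g.continuous.continuousAt
        (continuousAt_toHopfCover hp)
    filter_upwards [c.open_target.mem_nhds hpt, hcont.eventually hgc] with r hr hr'
    simp only [Function.comp_apply]
    rw [(hc_symm c hc r hr).2, ← h, hr']
  rw [mem_leafAut_iff, mem_leafAut_hopfCover_iff]
  constructor
  · intro H p hp
    exact ⟨up f g h (fun c hc c' hc' => (H c hc c' hc').1) p hp,
      up f.symm g.symm h' (fun c hc c' hc' => (H c hc c' hc').2) p hp⟩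
  · intro H c hc c' hc'
    exact ⟨fun q hq hq' => down f g h c hc c' hc' q hq hq' (H q (hc_symm c hc q hq).1).1,
      fun q hq hq' => down f.symm g.symm h' c hc c' hc' q hq hq' (H q (hc_symm c hc q hq).1).2⟩

end HopfData

end

noncomputable section

open LeafModel

/-! ### Entire functions of linear growth -/

/-- Cauchy's estimate bounds the derivative and Liouville's theorem makes it constant. Writing the
slope as `f 2 - f 1` uses only points `z ≠ 0`, so that it still makes sense on the boundary leaf. -/
theorem Complex.eq_affine_of_linear_growth {f : ℂ → ℂ} (hf : Differentiable ℂ f) {M : ℝ}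
    (hM : ∀ z, 1 ≤ ‖z‖ → ‖f z‖ ≤ M * ‖z‖) (z : ℂ) : f z = (f 2 - f 1) * z + f 0 := by
  have hM0 : 0 ≤ M := by
    have := (norm_nonneg _).trans (hM 1 (by simp))
    simpa using this
  have hbd : ∀ z, ‖deriv f z‖ ≤ 2 * M := by
    intro z
    have hR : 0 < ‖z‖ + 1 := by positivity
    -- The circle of radius `‖z‖ + 1` about `z` stays outside the open unit disc, where the growth
    -- bound is available, and gives a bound independent of `z`.
    have h := Complex.norm_deriv_le_of_forall_mem_sphere_norm_le (f := f) (c := z)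
      (C := 2 * M * (‖z‖ + 1)) hR hf.diffContOnCl fun ζ hζ => by
        rw [mem_sphere_iff_norm] at hζ
        have h1 : 1 ≤ ‖ζ‖ := by
          have := norm_sub_le ζ z
          linarith
        have h2 : ‖ζ‖ ≤ 2 * (‖z‖ + 1) := by
          have := norm_add_le (ζ - z) z
          rw [sub_add_cancel] at this
          linarith
        calc ‖f ζ‖ ≤ M * ‖ζ‖ := hM ζ h1
          _ ≤ M * (2 * (‖z‖ + 1)) := by gcongr
          _ = _ := by ring
    rwa [mul_div_assoc, div_self hR.ne', mul_one] at h
  have hd : Differentiable ℂ (deriv f) := hf.contDiff.differentiable_deriv_two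
  have hconst : ∀ z, deriv f z = deriv f 0 := fun z =>
    hd.apply_eq_apply_of_bounded
      (isBounded_iff_forall_norm_le.2 ⟨2 * M, by rintro _ ⟨w, rfl⟩; exact hbd w⟩) z 0
  have hlin : ∀ z, f z = deriv f 0 * z + f 0 := by
    intro z
    have h := is_const_of_deriv_eq_zero (f := fun w => f w - deriv f 0 * w) (by fun_prop)
      (fun w => by
        rw [deriv_fun_sub (hf w) (by fun_prop), hconst w]
        simp) z 0
    simp only [mul_zero, sub_zero] at h
    linear_combination h
  rw [hlin 2, hlin 1, hlin z]
  ring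

/-! ### The transverse part of an automorphism -/

theorem isPreconnected_slice (x : ℝ≥0) :
    IsPreconnected {z : ℂ | ((z, x) : LeafModel) ∈ hopfCover} := by
  by_cases hx : x = 0
  · have : {z : ℂ | ((z, x) : LeafModel) ∈ hopfCover} = {0}ᶜ := by
      ext z
      simp [hopfCover, hx]
    rw [this]
    exact (isConnected_compl_singleton_of_one_lt_rank (by simp) 0).isPreconnected
  · have : {z : ℂ | ((z, x) : LeafModel) ∈ hopfCover} = univ := by
      ext z
      simp [hopfCover, hx]
    rw [this]
    exact isPreconnected_univ

theorem mem_hopfCover_of_fst {z : ℂ} (hz : z ≠ 0) (x : ℝ≥0) : ((z, x) : LeafModel) ∈ hopfCover := by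
  simp [hopfCover, hz]

theorem mem_hopfCover_of_snd (z : ℂ) {x : ℝ≥0} (hx : x ≠ 0) :
    ((z, x) : LeafModel) ∈ hopfCover := by
  simp [hopfCover, hx]

theorem LeafModel.smoothHalf_of_leafwiseAt {F : LeafModel → LeafModel} {z : ℂ}
    (h : ∀ x, LeafwiseAt F (z, x)) : SmoothHalf fun x => incl (F (z, x)) := by
  intro x hx
  obtain ⟨u, hu, hpu, H⟩ := h x.toNNReal
  have hx' : incl (z, x.toNNReal) = (z, x) := by simp [incl, Real.coe_toNNReal x hx]
  have h1 := H.smooth _ ⟨_, hpu, rfl⟩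
  rw [hx'] at h1
  have h2 : ContDiffWithinAt ℝ ∞ (fun y : ℝ => ((z, y) : ℂ × ℝ)) (Ici 0) x :=
    (contDiff_const.prodMk contDiff_id).contDiffWithinAt
  have h3 : (fun y : ℝ => ((z, y) : ℂ × ℝ)) ⁻¹' (incl '' u) ∈ 𝓝[Ici 0] x := by
    have hc : Continuous fun y : ℝ => ((z, y.toNNReal) : LeafModel) := by fun_prop
    filter_upwards [self_mem_nhdsWithin, mem_nhdsWithin_of_mem_nhds
      (hc.continuousAt.preimage_mem_nhds (hu.mem_nhds hpu))] with y hy hyu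
    exact ⟨_, hyu, by simp [incl, Real.coe_toNNReal y hy]⟩
  exact h1.comp_of_preimage_mem_nhdsWithin x h2 h3

/-- The foliated condition is only local, but each leaf is connected, including the punctured one at
`x = 0`. -/
theorem snd_eq_of_mem_leafAut {g : hopfCover ≃ₜ hopfCover} (hg : g ∈ leafAut hopfCover)
    {p q : hopfCover} (h : p.1.2 = q.1.2) : (g p).1.2 = (g q).1.2 := by
  obtain ⟨⟨z, x⟩, hp⟩ := p
  obtain ⟨⟨w, y⟩, hq⟩ := q
  obtain rfl : x = y := h
  have key := (isPreconnected_slice x).induction₂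
    (fun z w => (g (toHopfCover (z, x))).1.2 = (g (toHopfCover (w, x))).1.2)
    (fun z hz => ?_) (fun _ _ _ _ _ _ => Eq.trans) (fun _ _ _ _ => Eq.symm) hp hq
  · simpa only [toHopfCover_of_mem hp, toHopfCover_of_mem hq] using key
  · obtain ⟨u, hu, hzu, H⟩ := (mem_leafAut_hopfCover_iff.1 hg _ hz).1
    obtain ⟨v, hv, hzv, H⟩ := H.foliated _ hzu
    have hc : Continuous fun z : ℂ => ((z, x) : LeafModel) := by fun_prop
    filter_upwards [mem_nhdsWithin_of_mem_nhds
      (((hu.inter hv).preimage hc).mem_nhds (show z ∈ _ from ⟨hzu, hzv⟩))] with w hw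
    exact H _ ⟨hzu, hzv⟩ _ hw rfl

/-- An automorphism of `R̃` acts on the leaf space by a diffeomorphism of `[0, ∞)`. -/
theorem exists_transverse {g : hopfCover ≃ₜ hopfCover} (hg : g ∈ leafAut hopfCover) :
    ∃ η : DiffHalf, ∀ p, (g p).1.2 = (η : ℝ≥0 ≃ₜ ℝ≥0) p.1.2 := by
  -- The transversal `z = 1` misses the deleted point, so smoothness is obtained up to `x = 0`.
  let s : ℝ≥0 → hopfCover := fun x => ⟨(1, x), mem_hopfCover_of_fst one_ne_zero x⟩
  have hg' : g.symm ∈ leafAut hopfCover := (leafAut hopfCover).inv_mem hg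
  have smooth : ∀ g : hopfCover ≃ₜ hopfCover, g ∈ leafAut hopfCover →
      SmoothHalf fun x => ((g (s x)).1.2 : ℝ) := by
    intro g hg
    have h := smoothHalf_of_leafwiseAt (z := 1) fun x =>
      (mem_leafAut_hopfCover_iff.1 hg (1, x) (s x).2).1
    refine (contDiff_snd.comp_contDiffOn h).congr fun x _ => ?_
    have hs : toHopfCover (1, x.toNNReal) = s x.toNNReal := toHopfCover_coe (s x.toNNReal)
    simp only [Function.comp_apply, hs]
    rfl
  have inv : ∀ g : hopfCover ≃ₜ hopfCover, g.symm ∈ leafAut hopfCover → ∀ x,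
      (g.symm (s (g (s x)).1.2)).1.2 = x := by
    intro g hg' x
    rw [snd_eq_of_mem_leafAut hg' (p := s (g (s x)).1.2) (q := g (s x)) rfl,
      g.symm_apply_apply]
  let η : ℝ≥0 ≃ₜ ℝ≥0 :=
    { toFun := fun x => (g (s x)).1.2
      invFun := fun x => (g.symm (s x)).1.2
      left_inv := inv g hg'
      right_inv := inv g.symm hg
      continuous_toFun := by fun_prop
      continuous_invFun := by fun_prop }
  exact ⟨⟨η, smooth g hg, smooth g.symm hg'⟩, fun p => snd_eq_of_mem_leafAut hg rfl⟩

theorem Homeomorph.nnreal_strictMono (f : ℝ≥0 ≃ₜ ℝ≥0) : StrictMono f := by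
  rcases f.continuous.strictMono_of_inj f.injective with h | h
  · exact h
  · have := h zero_lt_one
    rw [f.nnreal_map_zero] at this
    exact absurd this not_lt_zero

/-! ### Automorphisms commuting with `T` are affine along the leaves. -/

namespace HopfData

variable (D : HopfData)

theorem T_apply (p : hopfCover) :
    (D.T.1 p).1 = ((D.lam : ℂ) * p.1.1, (D.phi : ℝ≥0 ≃ₜ ℝ≥0) p.1.2) := rfl

theorem symm_phi_lt {x : ℝ≥0} (hx : 0 < x) : (D.phi : ℝ≥0 ≃ₜ ℝ≥0).symm x < x := by
  have h0 : 0 < (D.phi : ℝ≥0 ≃ₜ ℝ≥0).symm x := by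
    have := (D.phi : ℝ≥0 ≃ₜ ℝ≥0).symm.nnreal_strictMono hx
    rwa [Homeomorph.nnreal_map_zero] at this
  simpa using D.expanding _ h0

theorem symm_phi_le (x : ℝ≥0) : (D.phi : ℝ≥0 ≃ₜ ℝ≥0).symm x ≤ x := by
  rcases eq_or_lt_of_le (zero_le (a := x)) with rfl | hx
  · rw [Homeomorph.nnreal_map_zero]
  · exact (D.symm_phi_lt hx).le

theorem antitone_iterate_symm_phi (x : ℝ≥0) :
    Antitone fun n : ℕ => (D.phi : ℝ≥0 ≃ₜ ℝ≥0).symm^[n] x :=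
  antitone_nat_of_succ_le fun n => by
    rw [Function.iterate_succ_apply']
    exact D.symm_phi_le _

/-- The iterates decrease, their limit is a fixed point, and `0` is the only one. -/
theorem tendsto_iterate_symm_phi (x : ℝ≥0) :
    Filter.Tendsto (fun n : ℕ => (D.phi : ℝ≥0 ≃ₜ ℝ≥0).symm^[n] x) Filter.atTop (𝓝 0) := by
  have h := tendsto_atTop_ciInf (D.antitone_iterate_symm_phi x) (OrderBot.bddBelow _)
  have hfix := isFixedPt_of_tendsto_iterate h (D.phi : ℝ≥0 ≃ₜ ℝ≥0).symm.continuous.continuousAt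
  rcases eq_or_lt_of_le (zero_le (a := ⨅ n : ℕ, (D.phi : ℝ≥0 ≃ₜ ℝ≥0).symm^[n] x)) with h0 | h0
  · rwa [← h0] at h
  · exact absurd hfix (D.symm_phi_lt h0).ne

/-- No automorphism of `R̃` conjugates `T` to its inverse. -/
theorem not_conj_inv_T {g : hopfCover ≃ₜ hopfCover} (hg : g ∈ leafAut hopfCover) :
    ¬ ∀ p, g p = D.T.1 (g (D.T.1 p)) := by
  intro H
  obtain ⟨η, hη⟩ := exists_transverse hg
  -- On the leaf space this reads `η 1 = φ (η (φ 1))`, whose right side is strictly larger.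
  have h := congrArg (fun q : hopfCover => q.1.2) (H ⟨(1, 1), mem_hopfCover_of_fst one_ne_zero _⟩)
  simp only [T_apply, hη] at h
  have h1 := (η : ℝ≥0 ≃ₜ ℝ≥0).nnreal_strictMono (D.expanding 1 one_pos)
  have h2 := D.expanding _ (zero_le.trans_lt h1)
  exact absurd h (h1.trans h2).ne

/-- On the leaves, an automorphism that commutes with `T` has linear growth. -/
theorem exists_linear_growth {g : hopfCover ≃ₜ hopfCover}
    (hT : ∀ p, g (D.T.1 p) = D.T.1 (g p)) (x : ℝ≥0) :
    ∃ M : ℝ, ∀ z : ℂ, 1 ≤ ‖z‖ → ‖(g (toHopfCover (z, x))).1.1‖ ≤ M * ‖z‖ := by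
  have hl := D.one_lt_norm
  -- A fundamental annulus times `[0, x]`. The whole interval is needed because `T⁻¹` changes the
  -- leaf, but it keeps the height below `x`.
  let C : Set LeafModel := (Metric.closedBall 0 ‖(D.lam : ℂ)‖ \ Metric.ball 0 1) ×ˢ Icc 0 x
  have hC : IsCompact C :=
    ((isCompact_closedBall _ _).diff Metric.isOpen_ball).prod isCompact_Icc
  have hcont : ContinuousOn (fun p : LeafModel => (g (toHopfCover p)).1.1) C := by
    intro p hp
    have hp0 : p ∈ hopfCover := by
      refine mem_hopfCover_of_fst ?_ p.2
      intro h
      apply hp.1.2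
      simp [h]
    have := continuousAt_toHopfCover hp0
    have h2 : Continuous fun q : hopfCover => (g q).1.1 := by fun_prop
    exact (ContinuousAt.comp (f := toHopfCover) h2.continuousAt this).continuousWithinAt
  obtain ⟨M, hM⟩ := hC.exists_bound_of_continuousOn hcont
  have hM1 : ∀ t ≤ x, ∀ z : ℂ, 1 ≤ ‖z‖ → ‖z‖ ≤ ‖(D.lam : ℂ)‖ →
      ‖(g (toHopfCover (z, t))).1.1‖ ≤ M * ‖z‖ := by
    intro t ht z hz hz'
    have h1 := hM (z, t) ⟨⟨by simpa using hz', by simpa using hz⟩, zero_le, ht⟩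
    have hM0 := (norm_nonneg _).trans h1
    exact h1.trans (le_mul_of_one_le_right hM0 hz)
  -- By equivariance, applying `T` multiplies both sides by `‖λ‖`, so the same `M` works for every
  -- `n`.
  have hind : ∀ n : ℕ, ∀ t ≤ x, ∀ z : ℂ, 1 ≤ ‖z‖ → ‖z‖ ≤ ‖(D.lam : ℂ)‖ ^ (n + 1) →
      ‖(g (toHopfCover (z, t))).1.1‖ ≤ M * ‖z‖ := by
    intro n
    induction n with
    | zero => simpa using hM1
    | succ n ih =>
      intro t ht z hz hz'
      by_cases hzl : ‖z‖ ≤ ‖(D.lam : ℂ)‖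
      · exact hM1 t ht z hz hzl
      have hl0 : 0 < ‖(D.lam : ℂ)‖ := by linarith
      have hn : ‖(D.lam : ℂ)⁻¹ * z‖ = ‖z‖ / ‖(D.lam : ℂ)‖ := by
        rw [norm_mul, norm_inv]
        field_simp
      have h1 : 1 ≤ ‖(D.lam : ℂ)⁻¹ * z‖ := by
        rw [hn, one_le_div hl0]
        exact (not_le.1 hzl).le
      have h2 := ih ((D.phi : ℝ≥0 ≃ₜ ℝ≥0).symm t) ((D.symm_phi_le t).trans ht)
        ((D.lam : ℂ)⁻¹ * z) h1 (by
          rw [hn, div_le_iff₀ hl0, ← pow_succ]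
          exact hz')
      have hz0 : z ≠ 0 := norm_pos_iff.1 (by linarith)
      have hmem := mem_hopfCover_of_fst (z := (D.lam : ℂ)⁻¹ * z) (by simp [hz0])
        ((D.phi : ℝ≥0 ≃ₜ ℝ≥0).symm t)
      have h3 : toHopfCover (z, t) = D.T.1 ⟨_, hmem⟩ := by
        rw [toHopfCover_of_mem (mem_hopfCover_of_fst hz0 t)]
        ext1
        rw [T_apply]
        simp
      rw [toHopfCover_of_mem hmem] at h2
      rw [h3, hT, T_apply, norm_mul]
      calc _ ≤ ‖(D.lam : ℂ)‖ * (M * ‖(D.lam : ℂ)⁻¹ * z‖) := by gcongr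
        _ = M * ‖z‖ := by
          rw [hn]
          field_simp
  refine ⟨M, fun z hz => ?_⟩
  obtain ⟨n, hn⟩ := pow_unbounded_of_one_lt ‖z‖ hl
  refine hind n x le_rfl z hz (hn.le.trans ?_)
  exact pow_le_pow_right₀ hl.le (Nat.le_succ n)

/-- The automorphisms of `R̃` that commute with `T` are the maps `(a z + b(x), η(x))`. -/
theorem exists_affine {g : hopfCover ≃ₜ hopfCover} (hg : g ∈ leafAut hopfCover)
    (hT : ∀ p, g (D.T.1 p) = D.T.1 (g p)) :
    ∃ (a : ℂˣ) (η : D.Z) (b : D.K), ∀ p : hopfCover,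
      (g p).1 = ((a : ℂ) * p.1.1 + (b : ℝ≥0 → ℂ) p.1.2, ((η : DiffHalf) : ℝ≥0 ≃ₜ ℝ≥0) p.1.2) := by
  obtain ⟨η, hη⟩ := exists_transverse hg
  let w : ℂ → ℝ≥0 → ℂ := fun z x => (g (toHopfCover (z, x))).1.1
  have hw : ∀ p : hopfCover, (g p).1.1 = w p.1.1 p.1.2 := fun p => by simp [w]
  have hwT : ∀ z x, ((z, x) : LeafModel) ∈ hopfCover →
      w (D.lam * z) ((D.phi : ℝ≥0 ≃ₜ ℝ≥0) x) = D.lam * w z x := by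
    intro z x h
    have h1 := congrArg (fun q : hopfCover => q.1.1) (hT ⟨(z, x), h⟩)
    simp only [T_apply, hw] at h1
    exact h1
  have hwc : ∀ z, z ≠ 0 → Continuous (w z) := by
    intro z hz
    have h1 : w z = fun x => (g ⟨(z, x), mem_hopfCover_of_fst hz x⟩).1.1 := by
      funext x
      exact (hw ⟨(z, x), mem_hopfCover_of_fst hz x⟩).symm
    rw [h1]
    fun_prop
  have haff : ∀ x, x ≠ 0 → ∀ z, w z x = (w 2 x - w 1 x) * z + w 0 x := by
    intro x hx
    obtain ⟨M, hM⟩ := D.exists_linear_growth hT x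
    refine Complex.eq_affine_of_linear_growth (fun z => ?_) hM
    obtain ⟨u, hu, hpu, H⟩ := (mem_leafAut_hopfCover_iff.1 hg _ (mem_hopfCover_of_snd z hx)).1
    exact H.holomorphic _ hpu
  have hAc : Continuous fun x => w 2 x - w 1 x := (hwc 2 two_ne_zero).sub (hwc 1 one_ne_zero)
  have hl0 : (D.lam : ℂ) ≠ 0 := D.lam.ne_zero
  have hφ0 : ∀ x, x ≠ 0 → (D.phi : ℝ≥0 ≃ₜ ℝ≥0) x ≠ 0 := fun x hx =>
    (zero_le.trans_lt (D.expanding x (pos_iff_ne_zero.2 hx))).ne'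
  -- Source and target are both scaled by `λ`, so the factors cancel in the slope.
  have hAφ : ∀ x, w 2 ((D.phi : ℝ≥0 ≃ₜ ℝ≥0) x) - w 1 ((D.phi : ℝ≥0 ≃ₜ ℝ≥0) x) =
      w 2 x - w 1 x := by
    intro x
    by_cases hx : x = 0
    · rw [hx, Homeomorph.nnreal_map_zero]
    have h1 := hwT 2 x (mem_hopfCover_of_snd _ hx)
    have h2 := hwT 1 x (mem_hopfCover_of_snd _ hx)
    rw [haff _ (hφ0 x hx)] at h1 h2
    refine mul_left_cancel₀ hl0 ?_
    linear_combination h1 - h2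
  have hA : ∀ x, w 2 x - w 1 x = w 2 0 - w 1 0 := by
    intro x
    have hn : ∀ n : ℕ, w 2 ((D.phi : ℝ≥0 ≃ₜ ℝ≥0).symm^[n] x) -
        w 1 ((D.phi : ℝ≥0 ≃ₜ ℝ≥0).symm^[n] x) = w 2 x - w 1 x := by
      intro n
      induction n with
      | zero => rfl
      | succ n ih =>
        rw [Function.iterate_succ_apply', ← ih, ← hAφ, Homeomorph.apply_symm_apply]
    have ht := (hAc.tendsto 0).comp (D.tendsto_iterate_symm_phi x)
    refine tendsto_nhds_unique ?_ ht
    refine tendsto_const_nhds.congr fun n => ?_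
    exact (hn n).symm
  set a : ℂ := w 2 0 - w 1 0 with ha
  -- For `x ≠ 0` this is the value at `z = 0`; read off at `z = 1` it is also defined, and smooth,
  -- at `x = 0`. The identities proved for `x ≠ 0` extend there by density.
  let b : ℝ≥0 → ℂ := fun x => w 1 x - a
  have hbc : Continuous b := (hwc 1 one_ne_zero).sub continuous_const
  have hdense : Dense ({0}ᶜ : Set ℝ≥0) := dense_compl_singleton 0
  have hb0 : ∀ x, x ≠ 0 → b x = w 0 x := by
    intro x hx
    have := haff x hx 1
    rw [hA x] at this
    simp only [b]
    linear_combination this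
  have hwab : ∀ z x, ((z, x) : LeafModel) ∈ hopfCover → w z x = a * z + b x := by
    have h1 : ∀ z x, x ≠ 0 → w z x = a * z + b x := by
      intro z x hx
      rw [haff x hx z, hA x, hb0 x hx]
    intro z x h
    by_cases hz : z = 0
    · refine h1 z x ?_
      rintro rfl
      exact h (by simp [hz])
    · refine congrFun (Continuous.ext_on hdense (hwc z hz) (g := fun x => a * z + b x)
        (by fun_prop) ?_) x
      exact fun x hx => h1 z x hx
  have hbT : ∀ x, b ((D.phi : ℝ≥0 ≃ₜ ℝ≥0) x) = D.lam * b x := by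
    refine congrFun (Continuous.ext_on hdense
      (f := fun x => b ((D.phi : ℝ≥0 ≃ₜ ℝ≥0) x)) (g := fun x => D.lam * b x)
      (by fun_prop) (by fun_prop) ?_)
    intro x hx
    have := hwT 0 x (mem_hopfCover_of_snd _ hx)
    rw [mul_zero] at this
    simp only
    rwa [hb0 x hx, hb0 _ (hφ0 x hx)]
  have hbs : SmoothHalf b := by
    have h := smoothHalf_of_leafwiseAt (z := 1) fun x =>
      (mem_leafAut_hopfCover_iff.1 hg (1, x) (mem_hopfCover_of_fst one_ne_zero x)).1
    exact (contDiff_fst.comp_contDiffOn h).sub contDiffOn_const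
  have ha0 : a ≠ 0 := by
    intro ha0
    have h1 : g ⟨(1, 1), mem_hopfCover_of_fst one_ne_zero _⟩ =
        g ⟨(2, 1), mem_hopfCover_of_fst two_ne_zero _⟩ := by
      refine Subtype.ext (Prod.ext ?_ ?_)
      · rw [hw, hw, hwab _ _ (mem_hopfCover_of_fst one_ne_zero _),
          hwab _ _ (mem_hopfCover_of_fst two_ne_zero _), ha0]
        simp
      · rw [hη, hη]
    have h2 := congrArg (fun q : hopfCover => q.1.1) (g.injective h1)
    norm_num at h2
  have hηZ : η ∈ D.Z := by
    rw [Subgroup.mem_centralizer_singleton_iff]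
    refine Subtype.ext (Homeomorph.ext fun x => ?_)
    have := congrArg (fun q : hopfCover => q.1.2)
      (hT ⟨(1, x), mem_hopfCover_of_fst one_ne_zero _⟩)
    simp only [T_apply, hη] at this
    exact this
  refine ⟨Units.mk0 a ha0, ⟨η, hηZ⟩, ⟨b, hbs, hbT⟩, fun p => Prod.ext ?_ (hη p)⟩
  rw [hw, hwab _ _ p.2]
  rfl

end HopfData

end

noncomputable section

/-! ### Archimedean ordered groups are commutative -/

/-- Hölder's argument. If there is a least element above `1`, its powers exhaust the group.
Otherwise a commutator above `1` would dominate some `d * d` with `d > 1`, while locating `a` and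
`b` between consecutive powers of `d` gives `a * b < d * d * (b * a)`. -/
theorem commute_of_archimedean {G : Type*} [Group G] [LinearOrder G] [MulLeftStrictMono G]
    [MulRightStrictMono G] (arch : ∀ a b : G, 1 < a → ∃ n : ℕ, b ≤ a ^ n) (a b : G) :
    a * b = b * a := by
  have : MulLeftMono G := mulLeftMono_of_mulLeftStrictMono G
  have : MulRightMono G := mulRightMono_of_mulRightStrictMono G
  have near : ∀ e : G, 1 < e → ∀ a : G, ∃ m : ℤ, e ^ m ≤ a ∧ a < e ^ (m + 1) := by
    intro e he a
    have hmono : ∀ m n : ℤ, m < n → e ^ m < e ^ n := by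
      intro m n h
      obtain ⟨k, rfl⟩ : ∃ k : ℕ, n = m + (k + 1 : ℕ) := ⟨(n - m - 1).toNat, by omega⟩
      rw [zpow_add, zpow_natCast]
      exact lt_mul_of_one_lt_right' _ (one_lt_pow' he (Nat.succ_ne_zero k))
    obtain ⟨n, hn⟩ := arch e a he
    obtain ⟨n', hn'⟩ := arch e a⁻¹ he
    obtain ⟨m, hm, hm'⟩ := Int.exists_greatest_of_bdd (P := fun m : ℤ => e ^ m ≤ a)
      ⟨n, fun m hm => by
        by_contra h
        have := hmono n m (not_le.1 h)
        rw [zpow_natCast] at this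
        exact absurd (this.trans_le hm) (not_lt.2 hn)⟩
      ⟨-n', by
        rw [zpow_neg, zpow_natCast]
        exact inv_le_of_inv_le' hn'⟩
    refine ⟨m, hm, not_le.1 fun h => ?_⟩
    have := hm' _ h
    omega
  by_cases hmin : ∃ e : G, 1 < e ∧ ∀ x, 1 < x → e ≤ x
  · obtain ⟨e, he, hmin⟩ := hmin
    have hpow : ∀ a : G, ∃ m : ℤ, a = e ^ m := by
      intro a
      obtain ⟨m, hm, hm'⟩ := near e he a
      refine ⟨m, ?_⟩
      by_contra hne
      have h1 : e ^ m < a := lt_of_le_of_ne hm (Ne.symm hne)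
      have h2 := hmin _ (lt_inv_mul_iff_mul_lt.2 (by rwa [mul_one]) : 1 < (e ^ m)⁻¹ * a)
      have h3 := (le_inv_mul_iff_mul_le.1 h2)
      rw [← zpow_add_one] at h3
      exact absurd hm' (not_lt.2 h3)
    obtain ⟨m, rfl⟩ := hpow a
    obtain ⟨n, rfl⟩ := hpow b
    rw [← zpow_add, ← zpow_add, add_comm]
  · push Not at hmin
    have half : ∀ c : G, 1 < c → ∃ d, 1 < d ∧ d * d ≤ c := by
      intro c hc
      obtain ⟨x, hx, hxc⟩ := hmin c hc
      have hy : 1 < x⁻¹ * c := lt_inv_mul_iff_mul_lt.2 (by rwa [mul_one])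
      refine ⟨min x (x⁻¹ * c), lt_min hx hy, ?_⟩
      calc _ ≤ x * (x⁻¹ * c) := mul_le_mul' (min_le_left _ _) (min_le_right _ _)
        _ = c := by group
    have key : ∀ a b : G, ¬ b * a < a * b := by
      intro a b h
      obtain ⟨d, hd, hdc⟩ := half (a * b * (b * a)⁻¹) (by
        rw [lt_mul_inv_iff_mul_lt, one_mul]
        exact h)
      obtain ⟨m, hm, hm'⟩ := near d hd a
      obtain ⟨n, hn, hn'⟩ := near d hd b
      have h1 : a * b < d * d * (b * a) :=
        calc a * b < d ^ (m + 1) * d ^ (n + 1) := Left.mul_lt_mul hm' hn'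
          _ = d * d * (d ^ n * d ^ m) := by group
          _ ≤ d * d * (b * a) := by gcongr
      rw [le_mul_inv_iff_mul_le] at hdc
      exact absurd h1 (not_lt.2 hdc)
    exact le_antisymm (not_lt.1 (key a b)) (not_lt.1 (key b a))

/-! ### Derivatives of diffeomorphisms of the half line -/

namespace DiffHalf

/-- The derivative of a diffeomorphism of `[0, ∞)`. -/
def der (η : DiffHalf) (x : ℝ) : ℝ :=
  derivWithin (fun x : ℝ => ((η : ℝ≥0 ≃ₜ ℝ≥0) x.toNNReal : ℝ)) (Ici 0) x

theorem hasDerivWithinAt (η : DiffHalf) {x : ℝ} (hx : 0 ≤ x) :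
    HasDerivWithinAt (fun x : ℝ => ((η : ℝ≥0 ≃ₜ ℝ≥0) x.toNNReal : ℝ)) (der η x) (Ici 0) x :=
  ((η.2.1.differentiableOn (by simp)) x hx).hasDerivWithinAt

theorem contDiffOn_der (η : DiffHalf) : ContDiffOn ℝ 1 (der η) (Ici 0) :=
  ContDiffOn.derivWithin η.2.1 (uniqueDiffOn_Ici 0) (by norm_cast)

/-- Monotonicity gives a nonnegative derivative, and the chain rule for `η⁻¹ ∘ η` excludes zero. -/
theorem der_pos (η : DiffHalf) {x : ℝ} (hx : 0 ≤ x) : 0 < der η x := by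
  have h0 : 0 ≤ der η x := by
    refine MonotoneOn.derivWithin_nonneg fun x _ y _ hxy => ?_
    exact_mod_cast (η : ℝ≥0 ≃ₜ ℝ≥0).nnreal_strictMono.monotone (Real.toNNReal_mono hxy)
  refine lt_of_le_of_ne h0 fun h => ?_
  have h1 := hasDerivWithinAt η⁻¹ (x := (η : ℝ≥0 ≃ₜ ℝ≥0) x.toNNReal) NNReal.zero_le_coe
  have h2 := h1.comp x (hasDerivWithinAt η hx) fun y _ => NNReal.zero_le_coe
  rw [← h, mul_zero] at h2
  have h3 : HasDerivWithinAt (fun y : ℝ => y) 0 (Ici 0) x := by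
    refine h2.congr (fun y hy => ?_) ?_
    · simp only [Function.comp_apply, Real.toNNReal_coe]
      change y = (((η : ℝ≥0 ≃ₜ ℝ≥0).symm ((η : ℝ≥0 ≃ₜ ℝ≥0) y.toNNReal) : ℝ≥0) : ℝ)
      rw [Homeomorph.symm_apply_apply, Real.coe_toNNReal y hy]
    · simp only [Function.comp_apply, Real.toNNReal_coe]
      change x = (((η : ℝ≥0 ≃ₜ ℝ≥0).symm ((η : ℝ≥0 ≃ₜ ℝ≥0) x.toNNReal) : ℝ≥0) : ℝ)
      rw [Homeomorph.symm_apply_apply, Real.coe_toNNReal x hx]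
  have := (uniqueDiffOn_Ici (0 : ℝ) x hx).eq_deriv _ h3 (hasDerivWithinAt_id x _)
  exact zero_ne_one this

theorem exists_sub_eq_der_mul (η : DiffHalf) {x y : ℝ≥0} (hxy : x ≤ y) :
    ∃ ξ : ℝ≥0, x ≤ ξ ∧ ξ ≤ y ∧
      ((η : ℝ≥0 ≃ₜ ℝ≥0) y : ℝ) - (η : ℝ≥0 ≃ₜ ℝ≥0) x = der η ξ * (y - x) := by
  rcases eq_or_lt_of_le hxy with rfl | hlt
  · exact ⟨x, le_rfl, le_rfl, by simp⟩
  have hlt' : (x : ℝ) < y := by exact_mod_cast hlt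
  obtain ⟨ξ, hξ, h⟩ := exists_hasDerivAt_eq_slope
    (fun x : ℝ => ((η : ℝ≥0 ≃ₜ ℝ≥0) x.toNNReal : ℝ)) (der η) hlt'
    (η.2.1.continuousOn.mono fun z hz => (NNReal.zero_le_coe (q := x)).trans hz.1)
    fun z hz => by
      have hz0 : 0 < z := (NNReal.zero_le_coe (q := x)).trans_lt hz.1
      exact (hasDerivWithinAt η hz0.le).hasDerivAt (Ici_mem_nhds hz0)
  have hξ0 : 0 ≤ ξ := ((NNReal.zero_le_coe (q := x)).trans_lt hξ.1).le
  obtain ⟨ξ, rfl⟩ := CanLift.prf (β := ℝ≥0) ξ hξ0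
  refine ⟨ξ, by exact_mod_cast hξ.1.le, by exact_mod_cast hξ.2.le, ?_⟩
  have hne : (y : ℝ) - x ≠ 0 := (sub_pos.2 hlt').ne'
  simp only [Real.toNNReal_coe] at h
  rw [h, div_mul_cancel₀ _ hne]

/-- The logarithm of the derivative is `C¹`, hence Lipschitz on `[0, p]`. This is where smoothness
beyond `C¹` enters Kopell's lemma. -/
theorem exists_der_le_exp_mul (η : DiffHalf) (p : ℝ≥0) : ∃ C : ℝ, 0 ≤ C ∧
    ∀ x ≤ p, ∀ y ≤ p, der η x ≤ Real.exp (C * |(x : ℝ) - y|) * der η y := by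
  have hlog : ContDiffOn ℝ 1 (fun x => Real.log (der η x)) (Ici 0) :=
    (contDiffOn_der η).log fun x hx => (der_pos η hx).ne'
  have hcont := hlog.continuousOn_derivWithin (uniqueDiffOn_Ici 0) le_rfl
  obtain ⟨C, hC⟩ := (isCompact_Icc (a := (0 : ℝ)) (b := p)).exists_bound_of_continuousOn
    (hcont.mono fun x hx => hx.1)
  refine ⟨C, (norm_nonneg _).trans (hC 0 ⟨le_rfl, p.2⟩), fun x hx y hy => ?_⟩
  have h := Convex.norm_image_sub_le_of_norm_hasDerivWithin_le
    (fun z (hz : z ∈ Icc (0 : ℝ) p) =>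
      ((hlog.differentiableOn one_ne_zero z hz.1).hasDerivWithinAt).mono fun w hw => hw.1)
    hC (convex_Icc _ _) (x := (y : ℝ)) (y := (x : ℝ))
    ⟨y.2, by exact_mod_cast hy⟩ ⟨x.2, by exact_mod_cast hx⟩
  have h2 := (le_abs_self _).trans h
  have hx0 : 0 < der η x := der_pos η x.2
  have hy0 : 0 < der η y := der_pos η y.2
  calc der η x = Real.exp (Real.log (der η x)) := (Real.exp_log hx0).symm
    _ ≤ Real.exp (C * |(x : ℝ) - y| + Real.log (der η y)) := by
      refine Real.exp_le_exp.2 ?_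
      rw [Real.norm_eq_abs] at h2
      linarith
    _ = _ := by rw [Real.exp_add, Real.exp_log hy0]

/-- A diffeomorphism with fixed points that accumulate at `0` has derivative `1` there. -/
theorem exists_sub_le_two_mul (η : DiffHalf) {u : ℕ → ℝ≥0} (hu0 : ∀ n, u n ≠ 0)
    (hu : Filter.Tendsto u Filter.atTop (𝓝 0)) (hfix : ∀ n, (η : ℝ≥0 ≃ₜ ℝ≥0) (u n) = u n) :
    ∃ δ : ℝ≥0, 0 < δ ∧ ∀ x y : ℝ≥0, x ≤ y → y ≤ δ →
      ((η : ℝ≥0 ≃ₜ ℝ≥0) y : ℝ) - (η : ℝ≥0 ≃ₜ ℝ≥0) x ≤ 2 * (y - x) := by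
  -- The difference quotients at `0` along the fixed points `u n` all equal `1`.
  have hd : der η 0 = 1 := by
    have h := hasDerivWithinAt_iff_tendsto_slope.1 (hasDerivWithinAt η le_rfl)
    have hu' : Filter.Tendsto (fun n => (u n : ℝ)) Filter.atTop (𝓝[Ici 0 \ {0}] 0) := by
      refine tendsto_nhdsWithin_iff.2 ⟨?_, ?_⟩
      · simpa only [NNReal.coe_zero] using NNReal.tendsto_coe.2 hu
      · refine Filter.Eventually.of_forall fun n => ⟨(u n).2, ?_⟩
        simpa using hu0 n
    refine tendsto_nhds_unique (h.comp hu') (tendsto_const_nhds.congr fun n => ?_)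
    have hn : (u n : ℝ) ≠ 0 := by exact_mod_cast hu0 n
    simp [slope_def_field, hfix, Homeomorph.nnreal_map_zero, hn]
  have hev : ∀ᶠ x in 𝓝[Ici 0] (0 : ℝ), der η x < 2 := by
    refine ((contDiffOn_der η).continuousOn 0 (mem_Ici.2 le_rfl)).eventually_lt_const ?_
    rw [hd]
    norm_num
  obtain ⟨δ, hδ, H⟩ := (nhdsGE_basis_Icc (a := (0 : ℝ))).eventually_iff.1 hev
  refine ⟨⟨δ, hδ.le⟩, hδ, fun x y hxy hy => ?_⟩
  obtain ⟨ξ, -, hξy, e⟩ := exists_sub_eq_der_mul η hxy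
  rw [e]
  have h1 := (H ⟨ξ.2, hξy.trans hy⟩).le
  have h2 : (0 : ℝ) ≤ y - x := sub_nonneg.2 (by exact_mod_cast hxy)
  exact mul_le_mul_of_nonneg_right h1 h2

end DiffHalf

end

noncomputable section

/-! ### The centralizer of an expanding diffeomorphism is commutative -/

/-- Bounded distortion of the iterates of a contraction on a fundamental domain. -/
theorem iterate_sub_iterate_mem_Icc {F : ℝ≥0 → ℝ≥0} (hF : Monotone F) (hFle : ∀ x, F x ≤ x)
    {d : ℝ≥0 → ℝ} (hd : ∀ x, 0 < d x)
    (hmvt : ∀ x y : ℝ≥0, x ≤ y → ∃ ξ, x ≤ ξ ∧ ξ ≤ y ∧ (F y : ℝ) - F x = d ξ * (y - x))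
    {p : ℝ≥0} {C : ℝ} (hC0 : 0 ≤ C)
    (hC : ∀ x ≤ p, ∀ y ≤ p, d x ≤ Real.exp (C * |(x : ℝ) - y|) * d y)
    (n : ℕ) {x y : ℝ≥0} (hx : F p ≤ x) (hxy : x ≤ y) (hy : y ≤ p) :
    (F^[n] y : ℝ) - F^[n] x ∈ Icc
      (Real.exp (-(C * (p - F^[n] p))) * (∏ i ∈ Finset.range n, d (F^[i] p)) * (y - x))
      (Real.exp (C * (p - F^[n] p)) * (∏ i ∈ Finset.range n, d (F^[i] p)) * (y - x)) := by
  have hxy' : (0 : ℝ) ≤ y - x := sub_nonneg.2 (by exact_mod_cast hxy)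
  induction n with
  | zero => simp
  | succ n ih =>
    obtain ⟨ih1, ih2⟩ := ih
    have hn : ∀ {a b}, a ≤ b → F^[n] a ≤ F^[n] b := fun h => hF.iterate n h
    obtain ⟨ξ, hξ1, hξ2, e⟩ := hmvt _ _ (hn hxy)
    have hpn : F^[n] p ≤ p := by
      simpa using antitone_nat_of_succ_le (f := fun n => F^[n] p)
        (fun n => by rw [Function.iterate_succ_apply']; exact hFle _) (Nat.zero_le n)
    have hξp : ξ ≤ F^[n] p := hξ2.trans (hn hy)
    have hξp' : F^[n + 1] p ≤ ξ := (hn hx).trans hξ1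
    -- Both points lie in the `n`-th image of the fundamental domain. The lengths of these images
    -- telescope, which produces the exponent `p - F^[n] p`.
    have habs : |(ξ : ℝ) - F^[n] p| ≤ F^[n] p - F^[n + 1] p := by
      have h1 : (ξ : ℝ) ≤ F^[n] p := by exact_mod_cast hξp
      have h2 : (F^[n + 1] p : ℝ) ≤ ξ := by exact_mod_cast hξp'
      rw [abs_le]
      constructor <;> linarith
    have hexp : Real.exp (C * |(ξ : ℝ) - F^[n] p|) ≤
        Real.exp (C * (F^[n] p - F^[n + 1] p)) :=
      Real.exp_le_exp.2 (mul_le_mul_of_nonneg_left habs hC0)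
    have hup : d ξ ≤ Real.exp (C * (F^[n] p - F^[n + 1] p)) * d (F^[n] p) :=
      (hC _ (hξp.trans hpn) _ hpn).trans (mul_le_mul_of_nonneg_right hexp (hd _).le)
    have hlow : Real.exp (-(C * (F^[n] p - F^[n + 1] p))) * d (F^[n] p) ≤ d ξ := by
      have h := hC _ hpn _ (hξp.trans hpn)
      rw [abs_sub_comm] at h
      have h' := h.trans (mul_le_mul_of_nonneg_right hexp (hd ξ).le)
      rw [Real.exp_neg, inv_mul_le_iff₀ (Real.exp_pos _)]
      exact h'
    have hprod : 0 ≤ ∏ i ∈ Finset.range n, d (F^[i] p) :=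
      Finset.prod_nonneg fun i _ => (hd _).le
    rw [Function.iterate_succ_apply' F n y, Function.iterate_succ_apply' F n x, e,
      Finset.prod_range_succ]
    constructor
    · calc _ = (Real.exp (-(C * (F^[n] p - F^[n + 1] p))) * d (F^[n] p)) *
            (Real.exp (-(C * (p - F^[n] p))) * (∏ i ∈ Finset.range n, d (F^[i] p)) * (y - x)) := by
            have : Real.exp (-(C * ((p : ℝ) - F^[n + 1] p))) =
                Real.exp (-(C * (F^[n] p - F^[n + 1] p))) * Real.exp (-(C * (p - F^[n] p))) := by
              rw [← Real.exp_add]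
              congr 1
              ring
            rw [this]
            ring
        _ ≤ _ := mul_le_mul hlow ih1 (by positivity) (hd _).le
    · calc _ ≤ (Real.exp (C * (F^[n] p - F^[n + 1] p)) * d (F^[n] p)) *
            (Real.exp (C * (p - F^[n] p)) * (∏ i ∈ Finset.range n, d (F^[i] p)) * (y - x)) := by
            refine mul_le_mul hup ih2 (sub_nonneg.2 ?_) (mul_nonneg (Real.exp_pos _).le (hd _).le)
            exact_mod_cast hn hxy
        _ = _ := by
            have : Real.exp (C * ((p : ℝ) - F^[n + 1] p)) =
                Real.exp (C * (F^[n] p - F^[n + 1] p)) * Real.exp (C * (p - F^[n] p)) := by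
              rw [← Real.exp_add]
              congr 1
              ring
            rw [this]
            ring

/-! ### Kopell's lemma and commutativity of the centralizer. -/

namespace HopfData

variable (D : HopfData)

/-- `A` is the lower distortion bound. `K` is independent of `n` because the images of the
fundamental domain have total length at most `p`. -/
theorem exists_distortion (p : ℝ≥0) : ∃ K : ℝ, ∀ n : ℕ, ∃ A : ℝ, 0 < A ∧
    ∀ x y : ℝ≥0, (D.phi : ℝ≥0 ≃ₜ ℝ≥0).symm p ≤ x → x ≤ y → y ≤ p →
      A * (y - x) ≤ ((D.phi : ℝ≥0 ≃ₜ ℝ≥0).symm^[n] y : ℝ) - (D.phi : ℝ≥0 ≃ₜ ℝ≥0).symm^[n] x ∧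
      ((D.phi : ℝ≥0 ≃ₜ ℝ≥0).symm^[n] y : ℝ) - (D.phi : ℝ≥0 ≃ₜ ℝ≥0).symm^[n] x ≤
        K * (A * (y - x)) := by
  obtain ⟨C, hC0, hC⟩ := DiffHalf.exists_der_le_exp_mul D.phi⁻¹ p
  set F := (D.phi : ℝ≥0 ≃ₜ ℝ≥0).symm
  let d : ℝ≥0 → ℝ := fun x => DiffHalf.der D.phi⁻¹ x
  have hd : ∀ x, 0 < d x := fun x => DiffHalf.der_pos _ x.2
  refine ⟨Real.exp (2 * (C * p)), fun n =>
    ⟨Real.exp (-(C * (p - F^[n] p))) * ∏ i ∈ Finset.range n, d (F^[i] p),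
      mul_pos (Real.exp_pos _) (Finset.prod_pos fun i _ => hd _), fun x y hx hxy hy => ?_⟩⟩
  have h := iterate_sub_iterate_mem_Icc (F := F) F.nnreal_strictMono.monotone D.symm_phi_le hd
    (fun x y hxy => DiffHalf.exists_sub_eq_der_mul D.phi⁻¹ hxy) hC0 hC n hx hxy hy
  refine ⟨h.1, h.2.trans ?_⟩
  have hxy' : (0 : ℝ) ≤ y - x := sub_nonneg.2 (by exact_mod_cast hxy)
  have hprod : 0 ≤ ∏ i ∈ Finset.range n, d (F^[i] p) := Finset.prod_nonneg fun i _ => (hd _).le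
  rw [← mul_assoc, ← mul_assoc, ← Real.exp_add]
  have : C * ((p : ℝ) - F^[n] p) ≤ 2 * (C * p) + -(C * (p - F^[n] p)) := by
    have h1 : 0 ≤ C * (F^[n] p : ℝ) := mul_nonneg hC0 NNReal.zero_le_coe
    linarith
  gcongr

theorem Z_comm_symm_phi (h : D.Z) (x : ℝ≥0) :
    ((h : DiffHalf) : ℝ≥0 ≃ₜ ℝ≥0) ((D.phi : ℝ≥0 ≃ₜ ℝ≥0).symm x) =
      (D.phi : ℝ≥0 ≃ₜ ℝ≥0).symm (((h : DiffHalf) : ℝ≥0 ≃ₜ ℝ≥0) x) := by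
  have h1 := Subgroup.mem_centralizer_singleton_iff.1 h.2
  have h2 := congrArg (fun f : DiffHalf => (f : ℝ≥0 ≃ₜ ℝ≥0) ((D.phi : ℝ≥0 ≃ₜ ℝ≥0).symm x)) h1
  simp only [Subgroup.coe_mul, Homeomorph.mul_apply, Homeomorph.apply_symm_apply] at h2
  rw [Homeomorph.eq_symm_apply]
  exact h2.symm

theorem Z_comm_iterate_symm_phi (h : D.Z) (n : ℕ) (x : ℝ≥0) :
    ((h : DiffHalf) : ℝ≥0 ≃ₜ ℝ≥0) ((D.phi : ℝ≥0 ≃ₜ ℝ≥0).symm^[n] x) =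
      (D.phi : ℝ≥0 ≃ₜ ℝ≥0).symm^[n] (((h : DiffHalf) : ℝ≥0 ≃ₜ ℝ≥0) x) :=
  Function.Commute.iterate_right (f := ((h : DiffHalf) : ℝ≥0 ≃ₜ ℝ≥0)) (D.Z_comm_symm_phi h) n x

theorem Z_pow_apply (h : D.Z) (n : ℕ) (x : ℝ≥0) :
    (((h ^ n : D.Z) : DiffHalf) : ℝ≥0 ≃ₜ ℝ≥0) x = ((h : DiffHalf) : ℝ≥0 ≃ₜ ℝ≥0)^[n] x := by
  induction n with
  | zero => rfl
  | succ n ih =>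
    rw [Function.iterate_succ_apply', ← ih, pow_succ']
    rfl

theorem iterate_symm_phi_ne_zero {p : ℝ≥0} (hp : p ≠ 0) (n : ℕ) :
    (D.phi : ℝ≥0 ≃ₜ ℝ≥0).symm^[n] p ≠ 0 := by
  intro h
  apply hp
  refine (D.phi : ℝ≥0 ≃ₜ ℝ≥0).symm.injective.iterate n ?_
  rw [h]
  exact (Function.iterate_fixed (Homeomorph.nnreal_map_zero _) n).symm

/-- Since `h` fixes the whole backward orbit of `p`, it is `2`-Lipschitz near `0`. Conjugation by a
high iterate of `φ⁻¹` carries this to the fundamental domain at the cost of the distortion constant.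
The iterate depends on `h`, but the constant does not. -/
theorem exists_uniform_lipschitz {p : ℝ≥0} (hp : p ≠ 0) : ∃ K : ℝ, ∀ h : D.Z,
    ((h : DiffHalf) : ℝ≥0 ≃ₜ ℝ≥0) p = p → ∀ x ∈ Icc ((D.phi : ℝ≥0 ≃ₜ ℝ≥0).symm p) p,
    ∀ y ∈ Icc ((D.phi : ℝ≥0 ≃ₜ ℝ≥0).symm p) p,
      dist (((h : DiffHalf) : ℝ≥0 ≃ₜ ℝ≥0) x) (((h : DiffHalf) : ℝ≥0 ≃ₜ ℝ≥0) y) ≤ K * dist x y := by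
  obtain ⟨K, hK⟩ := D.exists_distortion p
  refine ⟨2 * K, fun h hfix => ?_⟩
  set H := ((h : DiffHalf) : ℝ≥0 ≃ₜ ℝ≥0) with hH
  have hmono : Monotone H := H.nnreal_strictMono.monotone
  have key : ∀ x y, (D.phi : ℝ≥0 ≃ₜ ℝ≥0).symm p ≤ x → x ≤ y → y ≤ p →
      (H y : ℝ) - H x ≤ 2 * K * (y - x) := by
    intro x y hx hxy hy
    obtain ⟨δ, hδ, Hδ⟩ := DiffHalf.exists_sub_le_two_mul (h : DiffHalf)
      (D.iterate_symm_phi_ne_zero hp) (D.tendsto_iterate_symm_phi p)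
      fun n => by rw [D.Z_comm_iterate_symm_phi, hfix]
    obtain ⟨n, hn⟩ := ((D.tendsto_iterate_symm_phi p).eventually_lt_const hδ).exists
    obtain ⟨A, hA, hAK⟩ := hK n
    have hitmono := (D.phi : ℝ≥0 ≃ₜ ℝ≥0).symm.nnreal_strictMono.monotone.iterate n
    have h1 := (hAK (H x) (H y)
      (by rw [← hfix, ← D.Z_comm_symm_phi]; exact hmono hx) (hmono hxy)
      ((hmono hy).trans_eq hfix)).1
    have h2 := (hAK x y hx hxy hy).2
    have h3 := Hδ _ _ (hitmono hxy) ((hitmono hy).trans hn.le)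
    rw [D.Z_comm_iterate_symm_phi, D.Z_comm_iterate_symm_phi] at h3
    have h4 : A * ((H y : ℝ) - H x) ≤ A * (2 * K * (y - x)) := by
      calc _ ≤ _ := h1
        _ ≤ _ := h3
        _ ≤ 2 * (K * (A * (y - x))) := by gcongr
        _ = _ := by ring
    exact le_of_mul_le_mul_left h4 hA
  intro x hx y hy
  rcases le_total x y with hxy | hxy
  · have h1 : (x : ℝ) ≤ y := by exact_mod_cast hxy
    have h2 : (H x : ℝ) ≤ H y := by exact_mod_cast hmono hxy
    rw [dist_comm, dist_comm x, NNReal.dist_eq, NNReal.dist_eq, abs_of_nonneg (by linarith),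
      abs_of_nonneg (by linarith)]
    exact key x y hx.1 hxy hy.2
  · have h1 : (y : ℝ) ≤ x := by exact_mod_cast hxy
    have h2 : (H y : ℝ) ≤ H x := by exact_mod_cast hmono hxy
    rw [NNReal.dist_eq, NNReal.dist_eq, abs_of_nonneg (by linarith), abs_of_nonneg (by linarith)]
    exact key y x hy.1 hxy hx.2

/-- The points `h⁻ⁿ x` converge monotonically to a fixed point `u`. All powers `hⁿ` share one
Lipschitz constant, so mapping back bounds the distance from `x` to `u` by a null sequence. -/
theorem fixed_of_mem_Icc {p : ℝ≥0} (hp : p ≠ 0) (h : D.Z)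
    (hfix : ((h : DiffHalf) : ℝ≥0 ≃ₜ ℝ≥0) p = p) {x : ℝ≥0}
    (hx : x ∈ Icc ((D.phi : ℝ≥0 ≃ₜ ℝ≥0).symm p) p) : ((h : DiffHalf) : ℝ≥0 ≃ₜ ℝ≥0) x = x := by
  obtain ⟨K, hK⟩ := D.exists_uniform_lipschitz hp
  set H := ((h : DiffHalf) : ℝ≥0 ≃ₜ ℝ≥0) with hH
  have hmono : Monotone H.symm := H.symm.nnreal_strictMono.monotone
  have hfix' : H.symm p = p := by rw [Homeomorph.symm_apply_eq, hfix]
  have hfix1 : H.symm ((D.phi : ℝ≥0 ≃ₜ ℝ≥0).symm p) = (D.phi : ℝ≥0 ≃ₜ ℝ≥0).symm p := by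
    rw [Homeomorph.symm_apply_eq, D.Z_comm_symm_phi, hfix]
  have hmem : ∀ n, H.symm^[n] x ∈ Icc ((D.phi : ℝ≥0 ≃ₜ ℝ≥0).symm p) p := by
    intro n
    constructor
    · rw [← Function.iterate_fixed hfix1 n]
      exact hmono.iterate n hx.1
    · rw [← Function.iterate_fixed hfix' n]
      exact hmono.iterate n hx.2
  obtain ⟨u, hu⟩ : ∃ u, Filter.Tendsto (fun n => H.symm^[n] x) Filter.atTop (𝓝 u) := by
    rcases le_total (H.symm x) x with hle | hle
    · exact ⟨_, tendsto_atTop_ciInf (hmono.antitone_iterate_of_map_le hle) (OrderBot.bddBelow _)⟩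
    · exact ⟨_, tendsto_atTop_ciSup (hmono.monotone_iterate_of_le_map hle)
        ⟨p, by rintro _ ⟨n, rfl⟩; exact (hmem n).2⟩⟩
  have hu1 : H.symm u = u := isFixedPt_of_tendsto_iterate hu H.symm.continuous.continuousAt
  have hu2 : H u = u := by rw [← Homeomorph.eq_symm_apply, hu1]
  have humem := isClosed_Icc.mem_of_tendsto hu (Filter.Eventually.of_forall hmem)
  have hbd : ∀ n : ℕ, dist x u ≤ K * dist (H.symm^[n] x) u := by
    intro n
    have h1 := hK (h ^ n) (by rw [D.Z_pow_apply]; exact Function.iterate_fixed hfix n) _ (hmem n)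
      u humem
    rw [D.Z_pow_apply, D.Z_pow_apply, Function.iterate_fixed hu2,
      (Function.LeftInverse.iterate H.apply_symm_apply n) x] at h1
    exact h1
  have hlim : Filter.Tendsto (fun n : ℕ => K * dist (H.symm^[n] x) u) Filter.atTop (𝓝 0) := by
    have := (tendsto_iff_dist_tendsto_zero.1 hu).const_mul K
    rwa [mul_zero] at this
  have hxu : x = u := dist_le_zero.1 (ge_of_tendsto' hlim hbd)
  rw [hxu, hu2]

/-- Kopell's lemma. -/
theorem eq_one_of_fixed {p : ℝ≥0} (hp : p ≠ 0) (h : D.Z)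
    (hfix : ((h : DiffHalf) : ℝ≥0 ≃ₜ ℝ≥0) p = p) : h = 1 := by
  refine Subtype.ext (Subtype.ext (Homeomorph.ext fun x => ?_))
  change ((h : DiffHalf) : ℝ≥0 ≃ₜ ℝ≥0) x = x
  by_cases hx : x = 0
  · rw [hx, Homeomorph.nnreal_map_zero]
  have hx' : 0 < x := pos_iff_ne_zero.2 hx
  obtain ⟨N, hN⟩ := ((D.tendsto_iterate_symm_phi x).eventually_lt_const
    (pos_iff_ne_zero.2 hp)).exists
  -- A fixed point above `x`; descending from it by `φ⁻¹`, the first step below `x` locates a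
  -- fundamental domain containing `x`.
  let q := (D.phi : ℝ≥0 ≃ₜ ℝ≥0)^[N] p
  have hqp : (D.phi : ℝ≥0 ≃ₜ ℝ≥0).symm^[N] q = p :=
    Function.LeftInverse.iterate (D.phi : ℝ≥0 ≃ₜ ℝ≥0).symm_apply_apply N p
  have hmonoN := (D.phi : ℝ≥0 ≃ₜ ℝ≥0).symm.nnreal_strictMono.iterate N
  have hq0 : q ≠ 0 := by
    intro h0
    apply hp
    rw [← hqp, h0]
    exact Function.iterate_fixed (Homeomorph.nnreal_map_zero _) N
  have hxq : x ≤ q := by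
    refine (hmonoN.lt_iff_lt.1 ?_).le
    rw [hqp]
    exact hN
  have hq : ((h : DiffHalf) : ℝ≥0 ≃ₜ ℝ≥0) q = q := by
    refine ((D.phi : ℝ≥0 ≃ₜ ℝ≥0).symm.injective.iterate N) ?_
    rw [← D.Z_comm_iterate_symm_phi, hqp, hfix]
  have hex : ∃ n : ℕ, (D.phi : ℝ≥0 ≃ₜ ℝ≥0).symm^[n] q < x :=
    ((D.tendsto_iterate_symm_phi q).eventually_lt_const hx').exists
  classical
  obtain ⟨n, hn⟩ : ∃ n, Nat.find hex = n + 1 := by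
    refine Nat.exists_eq_succ_of_ne_zero fun h0 => ?_
    have := Nat.find_spec hex
    rw [h0] at this
    exact absurd this (not_lt.2 hxq)
  have h1 := Nat.find_spec hex
  rw [hn, Function.iterate_succ_apply'] at h1
  have h2 := not_lt.1 (Nat.find_min hex (m := n) (by omega))
  exact D.fixed_of_mem_Icc (D.iterate_symm_phi_ne_zero hq0 n) h
    (by rw [D.Z_comm_iterate_symm_phi, hq]) ⟨h1.le, h2⟩

theorem eq_of_apply_eq {p : ℝ≥0} (hp : p ≠ 0) {h k : D.Z}
    (e : ((h : DiffHalf) : ℝ≥0 ≃ₜ ℝ≥0) p = ((k : DiffHalf) : ℝ≥0 ≃ₜ ℝ≥0) p) : h = k := by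
  refine inv_mul_eq_one.1 (D.eq_one_of_fixed hp (h⁻¹ * k) ?_)
  change ((h : DiffHalf) : ℝ≥0 ≃ₜ ℝ≥0).symm (((k : DiffHalf) : ℝ≥0 ≃ₜ ℝ≥0) p) = p
  rw [← e, Homeomorph.symm_apply_apply]

/-- The centralizer of an expanding diffeomorphism of `[0, ∞)` is commutative. -/
theorem Z_mul_comm (h k : D.Z) : h * k = k * h := by
  let ev : D.Z → ℝ≥0 := fun h => ((h : DiffHalf) : ℝ≥0 ≃ₜ ℝ≥0) 1
  have ev_mul : ∀ h k : D.Z, ev (h * k) = ((h : DiffHalf) : ℝ≥0 ≃ₜ ℝ≥0) (ev k) := fun _ _ => rfl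
  have ev_ne : ∀ h : D.Z, ev h ≠ 0 := by
    intro h h0
    refine one_ne_zero (((h : DiffHalf) : ℝ≥0 ≃ₜ ℝ≥0).injective (a₁ := 1) (a₂ := 0) ?_)
    rw [Homeomorph.nnreal_map_zero]
    exact h0
  let _ : LinearOrder D.Z := LinearOrder.lift' ev fun _ _ e => D.eq_of_apply_eq one_ne_zero e
  have le_def : ∀ h k : D.Z, h ≤ k ↔ ev h ≤ ev k := fun _ _ => Iff.rfl
  have : MulLeftStrictMono D.Z := ⟨fun g h k hk => by
    change ev (g * h) < ev (g * k)
    rw [ev_mul, ev_mul]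
    exact Homeomorph.nnreal_strictMono _ hk⟩
  have : MulRightStrictMono D.Z := ⟨fun g h k hk => by
    change ev (h * g) < ev (k * g)
    rw [ev_mul, ev_mul]
    -- If the order of `h` and `k` changed between `1` and `ev g`, they would agree at some positive
    -- point, hence be equal by freeness.
    by_contra hle
    obtain ⟨x, hx, e⟩ := (isPreconnected_Ioi (a := (0 : ℝ≥0))).intermediate_value₂
      (f := ((h : DiffHalf) : ℝ≥0 ≃ₜ ℝ≥0)) (g := ((k : DiffHalf) : ℝ≥0 ≃ₜ ℝ≥0))
      (mem_Ioi.2 one_pos) (mem_Ioi.2 (pos_iff_ne_zero.2 (ev_ne g)))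
      (Homeomorph.continuous _).continuousOn (Homeomorph.continuous _).continuousOn
      (le_of_lt hk) (not_lt.1 hle)
    have := D.eq_of_apply_eq (ne_of_gt hx) e
    exact absurd hk (by rw [this]; exact lt_irrefl _)⟩
  refine commute_of_archimedean (fun a b ha => ?_) h k
  by_contra hcon
  push Not at hcon
  set A := ((a : DiffHalf) : ℝ≥0 ≃ₜ ℝ≥0) with hA
  have ha1 : 1 < A 1 := ha
  have hpow : ∀ n : ℕ, A^[n] 1 ≤ ev b := fun n => by
    have := (hcon n).le
    rw [le_def] at this
    simp only [ev, D.Z_pow_apply] at this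
    exact this
  have hmono := A.nnreal_strictMono.monotone.monotone_iterate_of_le_map ha1.le
  have hbdd : BddAbove (range fun n : ℕ => A^[n] 1) :=
    ⟨ev b, by rintro _ ⟨n, rfl⟩; exact hpow n⟩
  -- A bounded orbit of `1` would converge to a positive fixed point of `a`, so Kopell's lemma would
  -- give `a = 1`.
  have hlim := tendsto_atTop_ciSup hmono hbdd
  have hfix := isFixedPt_of_tendsto_iterate hlim A.continuous.continuousAt
  have hge : 1 ≤ ⨆ n : ℕ, A^[n] 1 := le_ciSup hbdd 0
  have := D.eq_one_of_fixed (zero_lt_one.trans_le hge).ne' a hfix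
  rw [this] at ha
  exact lt_irrefl _ ha

end HopfData

end

noncomputable section

open LeafModel

namespace HopfData

variable (D : HopfData)

/-! ### Passing to the quotient -/

theorem AutT_comm_zpow (g : D.AutT) (n : ℤ) (p : hopfCover) :
    g.1.1 ((D.T ^ n : leafAut hopfCover).1 p) = (D.T ^ n : leafAut hopfCover).1 (g.1.1 p) := by
  have h : Commute g.1 D.T := Subgroup.mem_centralizer_singleton_iff.1 g.2
  exact congrArg (fun f : leafAut hopfCover => f.1 p) (h.zpow_right n)

theorem AutT_comm (g : D.AutT) (p : hopfCover) : g.1.1 (D.T.1 p) = D.T.1 (g.1.1 p) := by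
  simpa using D.AutT_comm_zpow g 1 p

theorem mem_AutT_of_comm {g : leafAut hopfCover} (h : ∀ p, g.1 (D.T.1 p) = D.T.1 (g.1 p)) :
    g ∈ D.AutT :=
  Subgroup.mem_centralizer_singleton_iff.2 (Subtype.ext (Homeomorph.ext h))

/-- The map of `R` that is induced by an automorphism of `R̃` that commutes with `T`. -/
def descendFun (g : D.AutT) : D.Reeb → D.Reeb :=
  Quotient.map g.1.1 fun p q ⟨n, hn⟩ => ⟨n, by rw [← D.AutT_comm_zpow, hn]⟩

theorem continuous_descendFun (g : D.AutT) : Continuous (D.descendFun g) :=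
  continuous_quot_lift _ (D.continuous_proj.comp g.1.1.continuous)

theorem descendFun_mul (g h : D.AutT) (q : D.Reeb) :
    D.descendFun (g * h) q = D.descendFun g (D.descendFun h q) := by
  obtain ⟨p, rfl⟩ := D.proj_surjective q
  rfl

theorem descendFun_one (q : D.Reeb) : D.descendFun 1 q = q := by
  obtain ⟨p, rfl⟩ := D.proj_surjective q
  rfl

/-- The homomorphism `Aut(R̃; T) → Aut R`. -/
def descend : D.AutT →* leafAut D.Reeb where
  toFun g := ⟨
    { toFun := D.descendFun g
      invFun := D.descendFun g⁻¹
      left_inv := fun q => by rw [← descendFun_mul, inv_mul_cancel, descendFun_one]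
      right_inv := fun q => by rw [← descendFun_mul, mul_inv_cancel, descendFun_one]
      continuous_toFun := D.continuous_descendFun g
      continuous_invFun := D.continuous_descendFun g⁻¹ },
    (D.mem_leafAut_reeb_iff fun _ => rfl).2 g.1.2⟩
  map_one' := Subtype.ext (Homeomorph.ext D.descendFun_one)
  map_mul' g h := Subtype.ext (Homeomorph.ext (D.descendFun_mul g h))

theorem descend_proj (g : D.AutT) (p : hopfCover) :
    (D.descend g).1 (D.proj p) = D.proj (g.1.1 p) := rfl

theorem descend_surjective : Function.Surjective D.descend := by
  intro f
  obtain ⟨g, hg⟩ := D.exists_lift f.1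
  have hgA : g ∈ leafAut hopfCover := (D.mem_leafAut_reeb_iff hg).1 f.2
  rcases D.lift_conj_T hg with h | h
  · refine ⟨⟨⟨g, hgA⟩, D.mem_AutT_of_comm h⟩, Subtype.ext (Homeomorph.ext fun q => ?_)⟩
    obtain ⟨p, rfl⟩ := D.proj_surjective q
    exact hg p
  · exact absurd h (D.not_conj_inv_T hgA)

theorem ker_descend : D.descend.ker = D.zpowersT := by
  ext g
  rw [MonoidHom.mem_ker, Subgroup.mem_zpowers_iff]
  constructor
  · intro h
    obtain ⟨n, hn⟩ := D.exists_eq_T_zpow_of_proj_eq continuous_id g.1.1.continuous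
      (fun p => by rw [← D.descend_proj, h]; rfl)
    exact ⟨n, Subtype.ext (Subtype.ext (Homeomorph.ext fun p => (hn p).symm))⟩
  · rintro ⟨n, rfl⟩
    refine Subtype.ext (Homeomorph.ext fun q => ?_)
    obtain ⟨p, rfl⟩ := D.proj_surjective q
    rw [D.descend_proj]
    exact D.proj_T_zpow n p

/-- The isomorphism `Aut(R̃; T) / T^ℤ ≅ Aut R`. -/
def descendEquiv : (D.AutT ⧸ D.zpowersT) ≃* leafAut D.Reeb :=
  (QuotientGroup.quotientMulEquivOfEq D.ker_descend.symm).trans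
    (QuotientGroup.quotientKerEquivOfSurjective D.descend D.descend_surjective)

/-! ### The action on `𝒦` -/

/-- The function `a⁻¹ (b ∘ η)`. -/
def twist (g : ℂˣ × D.Z) (b : D.K) : D.K :=
  ⟨fun x => (g.1 : ℂ)⁻¹ * (b : ℝ≥0 → ℂ) (((g.2 : DiffHalf) : ℝ≥0 ≃ₜ ℝ≥0) x),
    contDiffOn_const.mul (SmoothHalf.comp b.2.1 g.2.1.2.1), fun x => by
      have h := congrArg (fun f : DiffHalf => (f : ℝ≥0 ≃ₜ ℝ≥0) x)
        (Subgroup.mem_centralizer_singleton_iff.1 g.2.2)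
      simp only [Subgroup.coe_mul, Homeomorph.mul_apply] at h
      simp only
      rw [h, b.2.2]
      ring⟩

theorem twist_apply (g : ℂˣ × D.Z) (b : D.K) (x : ℝ≥0) :
    (D.twist g b : ℝ≥0 → ℂ) x =
      (g.1 : ℂ)⁻¹ * (b : ℝ≥0 → ℂ) (((g.2 : DiffHalf) : ℝ≥0 ≃ₜ ℝ≥0) x) := rfl

theorem prod_mul_comm (g h : ℂˣ × D.Z) : g * h = h * g :=
  Prod.ext (mul_comm _ _) (D.Z_mul_comm _ _)

/-- Precomposition reverses products, so commutativity of `Z_φ` is what makes this a left action. -/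
theorem twist_mul (g h : ℂˣ × D.Z) (b : D.K) : D.twist (g * h) b = D.twist g (D.twist h b) := by
  refine Subtype.ext (funext fun x => ?_)
  rw [D.prod_mul_comm g h]
  simp only [twist_apply, Prod.fst_mul, Prod.snd_mul, Units.val_mul, mul_inv_rev, mul_assoc]
  rfl

theorem twist_one (b : D.K) : D.twist 1 b = b := by
  refine Subtype.ext (funext fun x => ?_)
  rw [twist_apply]
  simp

theorem twist_add (g : ℂˣ × D.Z) (b c : D.K) : D.twist g (b + c) = D.twist g b + D.twist g c := by
  refine Subtype.ext (funext fun x => ?_)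
  exact mul_add _ _ _

theorem twist_lam_phi (b : D.K) : D.twist (D.lam, ⟨D.phi, D.phi_mem⟩) b = b := by
  refine Subtype.ext (funext fun x => ?_)
  rw [twist_apply]
  simp only
  rw [b.2.2, inv_mul_cancel_left₀ D.lam.ne_zero]

/-- The action of `ℂ* × Z_φ` on `𝒦`. -/
def twistHom : ℂˣ × D.Z →* MulAut (Multiplicative D.K) where
  toFun g :=
    { toFun := fun b => Multiplicative.ofAdd (D.twist g b.toAdd)
      invFun := fun b => Multiplicative.ofAdd (D.twist g⁻¹ b.toAdd)
      left_inv := fun b => by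
        simp only [toAdd_ofAdd]
        rw [← twist_mul, inv_mul_cancel, twist_one, ofAdd_toAdd]
      right_inv := fun b => by
        simp only [toAdd_ofAdd]
        rw [← twist_mul, mul_inv_cancel, twist_one, ofAdd_toAdd]
      map_mul' := fun b c => congrArg Multiplicative.ofAdd (D.twist_add g b.toAdd c.toAdd) }
  map_one' := MulEquiv.ext fun b => congrArg Multiplicative.ofAdd (D.twist_one b.toAdd)
  map_mul' g h := MulEquiv.ext fun b => congrArg Multiplicative.ofAdd (D.twist_mul g h b.toAdd)

theorem twistHom_apply (g : ℂˣ × D.Z) (b : Multiplicative D.K) :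
    D.twistHom g b = Multiplicative.ofAdd (D.twist g b.toAdd) := rfl

/-- The action of `(ℂ* × Z_φ) / (λ, φ)^ℤ` on `𝒦`. -/
def twistQuot : ((ℂˣ × D.Z) ⧸ D.zpowersLamPhi) →* MulAut (Multiplicative D.K) :=
  QuotientGroup.lift _ D.twistHom <| by
    rw [Subgroup.zpowers_le, MonoidHom.mem_ker]
    exact MulEquiv.ext fun b => congrArg Multiplicative.ofAdd (D.twist_lam_phi b.toAdd)

/-! ### Translations and diagonal maps -/

/-- At the fixed point `0` of `φ` the equation reads `b 0 = λ b 0`, with `λ ≠ 1`. Hence translations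
by `b` preserve the punctured leaf. -/
theorem K_zero (b : D.K) : (b : ℝ≥0 → ℂ) 0 = 0 := by
  have h := b.2.2 0
  rw [Homeomorph.nnreal_map_zero] at h
  have h1 : (D.lam : ℂ) - 1 ≠ 0 := by
    intro h0
    have h2 := D.one_lt_norm
    rw [sub_eq_zero.1 h0] at h2
    simp at h2
  refine (mul_eq_zero.1 (?_ : ((D.lam : ℂ) - 1) * (b : ℝ≥0 → ℂ) 0 = 0)).resolve_left h1
  linear_combination -h

theorem K_continuous (b : D.K) : Continuous (b : ℝ≥0 → ℂ) := by
  have h := b.2.1.continuousOn.comp_continuous NNReal.continuous_coe fun x => x.2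
  refine h.congr fun x => ?_
  simp

theorem translate_mem (b : D.K) (p : hopfCover) :
    ((p.1.1 + (b : ℝ≥0 → ℂ) p.1.2, p.1.2) : LeafModel) ∈ hopfCover := by
  intro h
  rw [mem_singleton_iff, Prod.ext_iff] at h
  obtain ⟨h1, h2⟩ := h
  simp only [Prod.fst_zero, Prod.snd_zero] at h1 h2
  rw [h2, K_zero, add_zero] at h1
  exact p.2 (Prod.ext h1 h2)

/-- The map `(z, x) ↦ (z + b(x), x)`. -/
def translateHomeo (b : D.K) : hopfCover ≃ₜ hopfCover where
  toFun p := ⟨(p.1.1 + (b : ℝ≥0 → ℂ) p.1.2, p.1.2), D.translate_mem b p⟩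
  invFun p := ⟨(p.1.1 + ((-b : D.K) : ℝ≥0 → ℂ) p.1.2, p.1.2), D.translate_mem (-b) p⟩
  left_inv p := by ext <;> simp
  right_inv p := by ext <;> simp
  continuous_toFun := by
    have := D.K_continuous b
    fun_prop
  continuous_invFun := by
    have := D.K_continuous (-b)
    fun_prop

theorem translateHomeo_apply (b : D.K) (p : hopfCover) :
    (D.translateHomeo b p : LeafModel) = (p.1.1 + (b : ℝ≥0 → ℂ) p.1.2, p.1.2) := rfl

theorem isLeafwise_translate (b : D.K) (s : Set LeafModel) :
    IsLeafwise (fun p => (p.1 + (b : ℝ≥0 → ℂ) p.2, p.2)) s where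
  smooth := by
    have hs : MapsTo Prod.snd (incl '' s) (Ici (0 : ℝ)) := by
      rintro _ ⟨p, -, rfl⟩
      exact p.2.2
    refine ContDiffOn.prodMk ?_ ?_
    · exact contDiff_fst.contDiffOn.add
        (ContDiffOn.comp (g := fun x : ℝ => (b : ℝ≥0 → ℂ) x.toNNReal) b.2.1
          contDiff_snd.contDiffOn hs)
    · exact ContDiffOn.comp (g := fun x : ℝ => (x.toNNReal : ℝ)) smoothHalf_id
        contDiff_snd.contDiffOn hs
  foliated p _ := ⟨univ, isOpen_univ, mem_univ p, fun q _ q' _ h => h⟩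
  holomorphic p _ := by
    simp only
    exact differentiableAt_fun_id.add_const _

theorem translateHomeo_mem (b : D.K) : D.translateHomeo b ∈ leafAut hopfCover := by
  rw [mem_leafAut_hopfCover_iff]
  have key : ∀ (b : D.K), ∀ p ∈ hopfCover,
      LeafwiseAt (fun q => (D.translateHomeo b (toHopfCover q) : LeafModel)) p := by
    intro b p hp
    have h : LeafwiseAt (fun p => (p.1 + (b : ℝ≥0 → ℂ) p.2, p.2)) p :=
      ⟨univ, isOpen_univ, mem_univ p, D.isLeafwise_translate b _⟩
    refine h.congr ?_
    filter_upwards [hopfCover.isOpen.mem_nhds hp] with q hq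
    rw [translateHomeo_apply, toHopfCover_of_mem hq]
  exact fun p hp => ⟨key b p hp, key (-b) p hp⟩

/-- The homomorphism from `𝒦` to `Aut(R̃; T)`. -/
def translate : Multiplicative D.K →* D.AutT where
  toFun b := ⟨⟨D.translateHomeo b.toAdd, D.translateHomeo_mem _⟩, D.mem_AutT_of_comm fun p =>
    Subtype.ext (by
      rw [T_apply]
      simp only [translateHomeo_apply, T_apply]
      rw [b.toAdd.2.2, mul_add])⟩
  map_one' := Subtype.ext (Subtype.ext (Homeomorph.ext fun p => Subtype.ext
    (Prod.ext (add_zero _) rfl)))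
  map_mul' b c := Subtype.ext (Subtype.ext (Homeomorph.ext fun p => Subtype.ext
    (Prod.ext (by
      change p.1.1 + ((b.toAdd : ℝ≥0 → ℂ) p.1.2 + (c.toAdd : ℝ≥0 → ℂ) p.1.2) =
        p.1.1 + (c.toAdd : ℝ≥0 → ℂ) p.1.2 + (b.toAdd : ℝ≥0 → ℂ) p.1.2
      ring) rfl)))

theorem translate_apply (b : Multiplicative D.K) (p : hopfCover) :
    ((D.translate b).1.1 p).1 = (p.1.1 + (b.toAdd : ℝ≥0 → ℂ) p.1.2, p.1.2) := rfl

/-- The homomorphism from `ℂ* × Z_φ` to `Aut(R̃; T)`. -/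
def diag : ℂˣ × D.Z →* D.AutT where
  toFun g := ⟨⟨hopfProd (g.1, g.2), hopfProd_mem _⟩, D.mem_AutT_of_comm fun p => by
    refine Subtype.ext (Prod.ext (mul_left_comm _ _ _) ?_)
    have h := congrArg (fun f : DiffHalf => (f : ℝ≥0 ≃ₜ ℝ≥0) p.1.2)
      (Subgroup.mem_centralizer_singleton_iff.1 g.2.2)
    exact h⟩
  map_one' := Subtype.ext (Subtype.ext (map_one hopfProd))
  map_mul' g h := Subtype.ext (Subtype.ext
    (map_mul hopfProd ((g.1, (g.2 : DiffHalf)) : ℂˣ × DiffHalf) (h.1, (h.2 : DiffHalf))))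

theorem diag_apply (g : ℂˣ × D.Z) (p : hopfCover) :
    ((D.diag g).1.1 p).1 = ((g.1 : ℂ) * p.1.1, ((g.2 : DiffHalf) : ℝ≥0 ≃ₜ ℝ≥0) p.1.2) := rfl

theorem diag_lam_phi : D.diag (D.lam, ⟨D.phi, D.phi_mem⟩) = ⟨D.T, D.T_mem⟩ := rfl

/-- The homomorphism from `(ℂ* × Z_φ) / (λ, φ)^ℤ` to `Aut(R̃; T) / T^ℤ`, by the inverses of the
diagonal maps. -/
def diagQuot : ((ℂˣ × D.Z) ⧸ D.zpowersLamPhi) →* D.AutT ⧸ D.zpowersT :=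
  QuotientGroup.lift _
    { toFun := fun g => ((D.diag g⁻¹ : D.AutT) : D.AutT ⧸ D.zpowersT)
      map_one' := by simp
      map_mul' := fun g h => by
        -- Inversion is a homomorphism only because the group is commutative.
        rw [D.prod_mul_comm g h, mul_inv_rev, map_mul, QuotientGroup.mk_mul] } <| by
    rw [Subgroup.zpowers_le, MonoidHom.mem_ker]
    refine (QuotientGroup.eq_one_iff _).2 ?_
    rw [map_inv, diag_lam_phi]
    exact inv_mem (Subgroup.mem_zpowers _)

/-- Going through `(a z, η x)`, translating, and returning adds `a⁻¹ b(η x)`. The diagonal map is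
applied first, which is why `(a, η)` must correspond to its inverse. -/
theorem translate_twist (g : ℂˣ × D.Z) (b : Multiplicative D.K) :
    D.translate (D.twistHom g b) = D.diag g⁻¹ * D.translate b * (D.diag g⁻¹)⁻¹ := by
  rw [eq_mul_inv_iff_mul_eq]
  refine Subtype.ext (Subtype.ext (Homeomorph.ext fun p => Subtype.ext ?_))
  change ((D.translate (D.twistHom g b)).1.1 ((D.diag g⁻¹).1.1 p)).1 =
    ((D.diag g⁻¹).1.1 ((D.translate b).1.1 p)).1
  rw [translate_apply, diag_apply, diag_apply, translate_apply, twistHom_apply, toAdd_ofAdd,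
    twist_apply]
  refine Prod.ext ?_ rfl
  have h : ((g.2 : DiffHalf) : ℝ≥0 ≃ₜ ℝ≥0) 
      ((((g⁻¹).2 : D.Z) : DiffHalf).1 p.1.2) = p.1.2 :=
    Homeomorph.apply_symm_apply _ _
  simp only
  rw [h, Prod.fst_inv, Units.val_inv_eq_inv_val, mul_add]

/-! ### The semidirect product decomposition. -/

/-- The homomorphism from the semidirect product to `Aut(R̃; T) / T^ℤ`. -/
def semidirectHom :
    Multiplicative D.K ⋊[D.twistQuot] ((ℂˣ × D.Z) ⧸ D.zpowersLamPhi) →* D.AutT ⧸ D.zpowersT :=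
  SemidirectProduct.lift ((QuotientGroup.mk' D.zpowersT).comp D.translate) D.diagQuot <| by
    intro q
    obtain ⟨g, rfl⟩ := QuotientGroup.mk_surjective q
    refine MonoidHom.ext fun b => ?_
    exact congrArg (QuotientGroup.mk' D.zpowersT) (D.translate_twist g b)

theorem semidirectHom_inl (b : Multiplicative D.K) : D.semidirectHom (SemidirectProduct.inl b) =
    ((D.translate b : D.AutT) : D.AutT ⧸ D.zpowersT) :=
  SemidirectProduct.lift_inl _ _ _ b

theorem semidirectHom_inr (g : ℂˣ × D.Z) :
    D.semidirectHom (SemidirectProduct.inr (g : (ℂˣ × D.Z) ⧸ D.zpowersLamPhi)) =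
      ((D.diag g⁻¹ : D.AutT) : D.AutT ⧸ D.zpowersT) :=
  SemidirectProduct.lift_inr _ _ _ _

theorem semidirectHom_surjective : Function.Surjective D.semidirectHom := by
  intro q
  obtain ⟨g, rfl⟩ := QuotientGroup.mk_surjective q
  obtain ⟨a, η, b, h⟩ := D.exists_affine g.1.2 (D.AutT_comm g)
  let k : ℂˣ × D.Z := (a, η)
  -- The translation acts after the diagonal map, so it must be by `b ∘ η⁻¹`.
  let c : D.K := D.twist (1, η⁻¹) b
  refine ⟨SemidirectProduct.inl (Multiplicative.ofAdd c) * SemidirectProduct.inr ((k⁻¹ : ℂˣ × D.Z) :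
    (ℂˣ × D.Z) ⧸ D.zpowersLamPhi), ?_⟩
  rw [map_mul, semidirectHom_inl, semidirectHom_inr, inv_inv, ← QuotientGroup.mk_mul]
  congr 1
  refine Subtype.ext (Subtype.ext (Homeomorph.ext fun p => Subtype.ext ?_))
  change ((D.translate (Multiplicative.ofAdd c)).1.1 ((D.diag k).1.1 p)).1 = _
  rw [translate_apply, diag_apply, h, toAdd_ofAdd, twist_apply]
  refine Prod.ext ?_ rfl
  have h : (((η⁻¹ : D.Z) : DiffHalf) : ℝ≥0 ≃ₜ ℝ≥0) (((η : DiffHalf) : ℝ≥0 ≃ₜ ℝ≥0) p.1.2) = p.1.2 :=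
    Homeomorph.symm_apply_apply _ _
  simp only [k]
  rw [h]
  simp

/-- The values at `z = 1` and `z = 2` determine an affine function of `z`, and both points exist on
every leaf. -/
theorem eq_one_of_translate_eq_diag {b : Multiplicative D.K} {g : ℂˣ × D.Z}
    (h : D.translate b = D.diag g) : b = 1 ∧ g = 1 := by
  have hp : ∀ p : hopfCover, ((p.1.1 + (b.toAdd : ℝ≥0 → ℂ) p.1.2, p.1.2) : LeafModel) =
      ((g.1 : ℂ) * p.1.1, ((g.2 : DiffHalf) : ℝ≥0 ≃ₜ ℝ≥0) p.1.2) := by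
    intro p
    rw [← translate_apply, ← diag_apply, h]
  have h1 := fun x => Prod.ext_iff.1 (hp ⟨(1, x), mem_hopfCover_of_fst one_ne_zero x⟩)
  have h2 := fun x => Prod.ext_iff.1 (hp ⟨(2, x), mem_hopfCover_of_fst two_ne_zero x⟩)
  simp only at h1 h2
  refine ⟨congrArg Multiplicative.ofAdd (Subtype.ext (funext fun x => ?_) : b.toAdd = 0),
    Prod.ext (Units.ext ?_) (Subtype.ext (Subtype.ext (Homeomorph.ext fun x => ?_)))⟩
  · change (b.toAdd : ℝ≥0 → ℂ) x = 0
    linear_combination 2 * (h1 x).1 - (h2 x).1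
  · change (g.1 : ℂ) = 1
    linear_combination (h1 0).1 - (h2 0).1
  · exact (h1 x).2.symm

theorem semidirectHom_injective : Function.Injective D.semidirectHom := by
  rw [injective_iff_map_eq_one]
  intro s hs
  obtain ⟨b, q⟩ := s
  obtain ⟨g, rfl⟩ := QuotientGroup.mk_surjective q
  rw [SemidirectProduct.mk_eq_inl_mul_inr, map_mul, semidirectHom_inl, semidirectHom_inr,
    ← QuotientGroup.mk_mul, QuotientGroup.eq_one_iff, Subgroup.mem_zpowers_iff] at hs
  obtain ⟨n, hn⟩ := hs
  -- `T ^ n` is itself diagonal, so the relation equates a translation with a diagonal map; both are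
  -- trivial.
  rw [← diag_lam_phi, ← map_zpow, map_inv, eq_mul_inv_iff_mul_eq, ← map_mul] at hn
  obtain ⟨rfl, hg⟩ := D.eq_one_of_translate_eq_diag hn.symm
  have hg' : ((g : ℂˣ × D.Z) : (ℂˣ × D.Z) ⧸ D.zpowersLamPhi) = 1 := by
    rw [QuotientGroup.eq_one_iff, ← inv_mem_iff, ← mul_eq_one_iff_eq_inv.1 hg]
    exact Subgroup.zpow_mem_zpowers _ _
  rw [hg']
  rfl

/-- The isomorphism of the semidirect product with `Aut R`. -/
def semidirectEquiv :
    Multiplicative D.K ⋊[D.twistQuot] ((ℂˣ × D.Z) ⧸ D.zpowersLamPhi) ≃* leafAut D.Reeb :=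
  (MulEquiv.ofBijective D.semidirectHom
    ⟨D.semidirectHom_injective, D.semidirectHom_surjective⟩).trans D.descendEquiv

theorem semidirectEquiv_apply
    (s : Multiplicative D.K ⋊[D.twistQuot] ((ℂˣ × D.Z) ⧸ D.zpowersLamPhi)) :
    D.semidirectEquiv s = D.descendEquiv (D.semidirectHom s) := rfl

end HopfData

end

theorem theorem3p7 (D : HopfData) :
    -- `Aut(R̃; T) / T^ℤ ≅ Aut R`, by passing to the quotient
    ∃ Φ : (D.AutT ⧸ D.zpowersT) ≃* leafAut D.Reeb,
      (∀ (g : D.AutT) (p : hopfCover), (Φ g : D.Reeb ≃ₜ D.Reeb) (D.proj p) =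
        D.proj (((g : leafAut hopfCover) : hopfCover ≃ₜ hopfCover) p)) ∧
    -- the action of `(ℂ* × Z_φ) / (λ, φ)^ℤ` on `𝒦_{λ,φ}`
    ∃ ρ : ((ℂˣ × D.Z) ⧸ D.zpowersLamPhi) →* MulAut (Multiplicative D.K),
      (∀ (a : ℂˣ) (η : D.Z) (b : D.K) (x : ℝ≥0),
        ((ρ ((a, η) : ℂˣ × D.Z) (Multiplicative.ofAdd b)).toAdd : ℝ≥0 → ℂ) x =
          (a : ℂ)⁻¹ * (b : ℝ≥0 → ℂ) (((η : DiffHalf) : ℝ≥0 ≃ₜ ℝ≥0) x)) ∧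
    -- `Aut R` is the semidirect product; `b` corresponds to the translation `(z + b(x), x)`, and
    -- the inverse of `(a, η)` to `(a z, η(x))`
    ∃ Ψ : leafAut D.Reeb ≃* Multiplicative D.K ⋊[ρ] ((ℂˣ × D.Z) ⧸ D.zpowersLamPhi),
      (∀ b : D.K, ∃ g : D.AutT,
        (∀ p : hopfCover, (((g : leafAut hopfCover) : hopfCover ≃ₜ hopfCover) p : LeafModel) =
          (p.1.1 + (b : ℝ≥0 → ℂ) p.1.2, p.1.2)) ∧
        Ψ (Φ g) = SemidirectProduct.inl (Multiplicative.ofAdd b)) ∧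
      (∀ (a : ℂˣ) (η : D.Z), ∃ g : D.AutT,
        (∀ p : hopfCover, (((g : leafAut hopfCover) : hopfCover ≃ₜ hopfCover) p : LeafModel) =
          ((a : ℂ) * p.1.1, ((η : DiffHalf) : ℝ≥0 ≃ₜ ℝ≥0) p.1.2)) ∧
        Ψ (Φ g) = SemidirectProduct.inr (((a, η) : ℂˣ × D.Z) :
          (ℂˣ × D.Z) ⧸ D.zpowersLamPhi)⁻¹) := by
  refine ⟨D.descendEquiv, fun g p => D.descend_proj g p, D.twistQuot, fun a η b x => rfl,
    D.semidirectEquiv.symm, fun b => ⟨D.translate (Multiplicative.ofAdd b), fun p => rfl, ?_⟩,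
    fun a η => ⟨D.diag (a, η), fun p => rfl, ?_⟩⟩
  · rw [MulEquiv.symm_apply_eq, D.semidirectEquiv_apply, D.semidirectHom_inl]
  · rw [MulEquiv.symm_apply_eq, D.semidirectEquiv_apply, ← QuotientGroup.mk_inv,
      D.semidirectHom_inr, inv_inv]
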